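/- Let $\mathbf K$ be an abstract elementary class with strong submodel relation $\le_{\mathbf K}$; write $A<_{\mathbf K}B$ for $A\le_{\mathbf K}B$ and $A\ne B$, and let $\mathbf K_\mu$ be the class of models in $\mathbf K$ of cardinality $\mu$. Types are Galois types; $S(A)$ is the set of all types over $A$, and $S^{\mathrm{na}}(A)$ is the set of non-algebraic types over $A$, i.e. those of the form $\mathrm{tp}(b/A;B)$ with $A\le_{\mathbf K}B\in\mathbf K$ and $b\in B\setminus A$. The class $\mathbf K_\mu$ is stable if $|S^{\mathrm{na}}(M)|\le\mu$ for all $M\in\mathbf K_\mu$; it has no maximal model if every $A\in\mathbf K_\mu$ has some $B\in\mathbf K_\mu$ with $A<_{\mathbf K}B$; and it has amalgamation if whenever $A,B,C\in\mathbf K_\mu$, $A\le_{\mathbf K}B$ and $A\le_{\mathbf K}C$, there are $D\in\mathbf K_\mu$ and $\mathbf K$-embeddings $f_B:B\to D$ and $f_C:C\to D$ with $f_B\restriction A=f_C\restriction A$. Such a triple $(f_B,f_C,D)$ is called a $\mu$-amalgamation of $B$ and $C$ over $A$. Two $\mu$-amalgamations $(f_B,f_C,D)$ and $(f'_B,f'_C,F)$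 of $B$ and $C$ over $A$ are equivalent if there are $G\in\mathbf K$ and $\mathbf K$-embeddings $g_D:D\to G$, $g_F:F\to G$ with $g_D\circ f_B=g_F\circ f'_B$ and $g_D\circ f_C=g_F\circ f'_C$. Let $A,B\in\mathbf K_\lambda$ with $A<_{\mathbf K}B$ and $b\in B\setminus A$. The triple $(A,B,b)$ is a $*$-domination triple in $\mathbf K_\lambda$ if there are no $C\in\mathbf K_\lambda$ with $A\le_{\mathbf K}C$ and non-equivalent $\lambda$-amalgamations $(f,\mathrm{id}_C,D)$ and $(f',\mathrm{id}_C,F)$ of $B$ and $C$ over $A$ such that $\mathrm{tp}(f(b)/C;D)=\mathrm{tp}(f'(b)/C;F)\in S^{\mathrm{na}}(C)$. Corollary 12.8. Suppose that: 1. $\lambda$ is an infinite cardinal such that $\diamondsuit(\lambda^+)$ holds; 2. $\mathrm{LST}(\mathbf K)\le\lambda$, and $\mathbf K_\lambda$ has amalgamation and no maximal model; 3. $\mathbf K_{\lambda^+}$ has amalgamation and is stable; 4. $A,B\in\mathbf K_\lambda$ satisfy $A<_{\mathbf K}B$, and $b\in B\setminus A$. Then there are $C,D\in\mathbf K_\lambda$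 such that $(C,D,b)$ is a $*$-domination triple in $\mathbf K_\lambda$, $A\le_{\mathbf K}C$ and $B\le_{\mathbf K}D$ (so that, in particular, $\mathrm{tp}(b/C;D)$ extends $\mathrm{tp}(b/A;B)$). -/

import Mathlib

universe u

open Cardinal
open scoped FirstOrder

/-- A `τ`-model whose universe is a set (an element of the class `ZFSet` of all sets), so that two
models can literally be contained in each other.  The vocabulary `τ` is the language `L`. -/
structure TauModel (L : FirstOrder.Language.{u, u}) : Type (u + 1) where
  /-- The universe of the model. -/
  carrier : ZFSet.{u}
  /-- The interpretation of the symbols. -/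
  [str : L.Structure carrier]

namespace TauModel

variable {L : FirstOrder.Language.{u, u}}

instance : CoeSort (TauModel L) (Type (u + 1)) := ⟨fun A => {x // x ∈ A.carrier}⟩

instance (A : TauModel L) : L.Structure A := A.str

/-- The cardinality of (the universe of) a model. -/
noncomputable def card (A : TauModel L) : Cardinal.{u} := A.carrier.card

/-- `A ⊆ B`: every element of `A` is an element of `B`, and the inclusion is an embedding of
first-order structures (it preserves functions and it preserves and reflects relations). -/
def Submodel (A B : TauModel L) : Prop :=
  ∃ i : A ↪[L] B, ∀ x : A, (i x : ZFSet.{u}) = x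

theorem Submodel.subset {A B : TauModel L} (h : A.Submodel B) : A.carrier ⊆ B.carrier := by
  obtain ⟨i, hi⟩ := h
  intro x hx
  have := (i ⟨x, hx⟩).2
  rwa [hi] at this

/-- `U` is the union of the models `A α`, `α < δ`. -/
def IsUnion (δ : Ordinal.{u}) (A : Ordinal.{u} → TauModel L) (U : TauModel L) : Prop :=
  (∀ x, x ∈ U.carrier ↔ ∃ α < δ, x ∈ (A α).carrier) ∧ ∀ α < δ, (A α).Submodel U

/-- `A' = φ[A]`, where `φ` is a function on a model `B` containing `A`: the restriction of `φ`
to `A` is an isomorphism of `A` onto `A'`. -/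
def IsImage {A B C : TauModel L} (φ : B → C) (hAB : A.Submodel B) (A' : TauModel L) : Prop :=
  ∃ ψ : A ≃[L] A', ∀ x : A, (ψ x : ZFSet.{u}) = φ ⟨x, hAB.subset x.2⟩

end TauModel

/-- The condition defining the Löwenheim–Skolem–Tarski number, for a class `mem` of models with
strong submodel relation `le`, at the cardinal `κ`. -/
def IsLSTCardinal {L : FirstOrder.Language.{u, u}} (mem : Set (TauModel L))
    (le : TauModel L → TauModel L → Prop) (κ : Cardinal.{u}) : Prop :=
  ℵ₀ ≤ κ ∧ L.card ≤ κ ∧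
    ∀ N ∈ mem, ∀ Z : ZFSet.{u}, Z ⊆ N.carrier →
      ∃ M ∈ mem, le M N ∧ M.card ≤ max κ Z.card ∧ Z ⊆ M.carrier

/-- An abstract elementary class in the vocabulary `L`. -/
structure AEC (L : FirstOrder.Language.{u, u}) where
  /-- The models of the class. -/
  mem : Set (TauModel L)
  /-- The strong submodel relation `≤_K`. -/
  le : TauModel L → TauModel L → Prop
  /-- `≤_K` is a relation on the class. -/
  le_mem : ∀ {A B}, le A B → A ∈ mem ∧ B ∈ mem
  /-- The class is closed under isomorphism. -/
  mem_of_equiv : ∀ {B C : TauModel L}, (B ≃[L] C) → B ∈ mem → C ∈ mem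
  /-- If `φ : B ≅ C` and `A ≤_K B`, then `φ[A] ≤_K C`. -/
  le_of_equiv : ∀ {A B C A' : TauModel L} (φ : B ≃[L] C) (hAB : A.Submodel B),
    le A B → TauModel.IsImage φ hAB A' → le A' C
  refl : ∀ {A}, A ∈ mem → le A A
  trans : ∀ {A B C}, le A B → le B C → le A C
  submodel : ∀ {A B}, le A B → A.Submodel B
  /-- The union of a nonempty increasing chain is in the class and is a strong extension of
  each member of the chain. -/
  union : ∀ (δ : Ordinal.{u}) (A : Ordinal.{u} → TauModel L) (U : TauModel L), 0 < δ →
    (∀ α < δ, A α ∈ mem) → (∀ α β, α ≤ β → β < δ → le (A α) (A β)) →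
    TauModel.IsUnion δ A U → U ∈ mem ∧ ∀ β < δ, le (A β) U
  /-- Smoothness, for increasing continuous sequences `⟨A α | α ≤ δ⟩` of limit length. -/
  smooth : ∀ (δ : Ordinal.{u}) (A : Ordinal.{u} → TauModel L) (N : TauModel L),
    Order.IsSuccLimit δ →
    (∀ α ≤ δ, A α ∈ mem) → (∀ α β, α ≤ β → β ≤ δ → le (A α) (A β)) →
    (∀ γ ≤ δ, Order.IsSuccLimit γ → TauModel.IsUnion γ A (A γ)) →
    N ∈ mem → (∀ α < δ, le (A α) N) → le (A δ) N
  coherence : ∀ {A B C}, A ∈ mem → B ∈ mem → C ∈ mem → A.Submodel B → B.Submodel C →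
    le A C → le B C → le A B
  exists_isLSTCardinal : ∃ κ, IsLSTCardinal mem le κ

namespace AEC

variable {L : FirstOrder.Language.{u, u}} (K : AEC L)

/-- The Löwenheim–Skolem–Tarski number: the smallest cardinal as in the last axiom. -/
noncomputable def LST : Cardinal.{u} := sInf {κ | IsLSTCardinal K.mem K.le κ}

/-- `A <_K B`. -/
def lt (A B : TauModel L) : Prop := K.le A B ∧ A ≠ B

/-- `K_μ`, the models of cardinality `μ`. -/
def ofCard (μ : Cardinal.{u}) : Set (TauModel L) := {A | A ∈ K.mem ∧ A.card = μ}

variable {K} in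
/-- The inclusion `id_A : A → B` for `A ≤_K B`. -/
def incl {A B : TauModel L} (h : K.le A B) : A → B :=
  fun x => ⟨x, (K.submodel h).subset x.2⟩

/-- `f : A → B` is a `K`-embedding: an isomorphism of `A` onto some `A' ≤_K B`. -/
def IsEmbedding {A B : TauModel L} (f : A → B) : Prop :=
  A ∈ K.mem ∧ B ∈ K.mem ∧
    ∃ A', K.le A' B ∧ ∃ ψ : A ≃[L] A', ∀ x : A, (ψ x : ZFSet.{u}) = f x

/-- `(fB, fC, D)` is an amalgamation of `B` and `C` over `A`, where `A ≤_K B` and `A ≤_K C`. -/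
def IsAmalgamation {A B C D : TauModel L} (hAB : K.le A B) (hAC : K.le A C)
    (fB : B → D) (fC : C → D) : Prop :=
  K.IsEmbedding fB ∧ K.IsEmbedding fC ∧ ∀ x : A, fB (incl hAB x) = fC (incl hAC x)

/-- Two amalgamations `(fB, fC, D)` and `(fB', fC', F)` of `B` and `C` over the same model are
equivalent: some `G ∈ K` and embeddings of `D` and `F` into `G` make the diagrams commute. -/
def EquivAmalgamation {B C D F : TauModel L} (fB : B → D) (fC : C → D) (fB' : B → F)
    (fC' : C → F) : Prop :=
  ∃ (G : TauModel L) (gD : D → G) (gF : F → G), K.IsEmbedding gD ∧ K.IsEmbedding gF ∧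
    (∀ x, gD (fB x) = gF (fB' x)) ∧ ∀ x, gD (fC x) = gF (fC' x)

/-- The amalgamation property for `K_μ`. -/
def AmalgamationProperty (μ : Cardinal.{u}) : Prop :=
  ∀ A ∈ K.ofCard μ, ∀ B ∈ K.ofCard μ, ∀ C ∈ K.ofCard μ, ∀ (hAB : K.le A B) (hAC : K.le A C),
    ∃ D ∈ K.ofCard μ, ∃ (fB : B → D) (fC : C → D), K.IsAmalgamation hAB hAC fB fC

/-- `K_μ` has no maximal model. -/
def NoMaximalModel (μ : Cardinal.{u}) : Prop :=
  ∀ A ∈ K.ofCard μ, ∃ B ∈ K.ofCard μ, K.lt A B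

/-! ### Galois types -/

/-- Pairs `(B, b)` with `A ≤_K B` and `b ∈ B`. -/
structure Pointed (A : TauModel L) : Type (u + 1) where
  /-- The ambient model. -/
  model : TauModel L
  le : K.le A model
  /-- The distinguished element. -/
  pt : model

/-- Atomic equivalence of pairs over `A`: the two ambient models can be amalgamated over `A` with
the two distinguished elements identified. -/
def Atomic {A : TauModel L} (p q : K.Pointed A) : Prop :=
  ∃ (G : TauModel L) (f : p.model → G) (g : q.model → G),
    K.IsAmalgamation p.le q.le f g ∧ f p.pt = g q.pt

/-- `S(A)`: the Galois types over `A`, the classes of the equivalence relation generated by atomic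
equivalence. -/
def GaloisType (A : TauModel L) : Type (u + 1) := Quot (K.Atomic (A := A))

variable {K} in
/-- `tp(b/A; B)`. -/
def tp {A B : TauModel L} (h : K.le A B) (b : B) : K.GaloisType A :=
  Quot.mk _ ⟨B, h, b⟩

variable {K} in
/-- The restriction `p ↾ A` of a type `p` over `C`, for `A ≤_K C`; it sends `tp(b/C; D)` to
`tp(b/A; D)`. -/
def GaloisType.restrict {A C : TauModel L} (h : K.le A C) : K.GaloisType C → K.GaloisType A :=
  Quot.map (fun p => ⟨p.model, K.trans h p.le, p.pt⟩) (by
    rintro p q ⟨G, f, g, ⟨hf, hg, hfg⟩, hpt⟩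
    exact ⟨G, f, g, ⟨hf, hg, fun x => hfg (incl h x)⟩, hpt⟩)

/-- `S^na(A)`: the non-algebraic types over `A`. -/
def Sna (A : TauModel L) : Set (K.GaloisType A) :=
  {p | ∃ (B : TauModel L) (h : K.le A B) (b : B), (b : ZFSet.{u}) ∉ A.carrier ∧ p = tp h b}

/-- `K_μ` is stable. -/
def Stable (μ : Cardinal.{u}) : Prop :=
  ∀ A ∈ K.ofCard μ, #(K.Sna A) ≤ Cardinal.lift.{u + 1} μ

/-! ### `*`-domination triples -/

/-- `C` witnesses the non-`*`-domination of `(A, B, b)` in `K_μ`. -/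
def WitnessesNonDomination (μ : Cardinal.{u}) {A B : TauModel L} (hAB : K.le A B) (b : B)
    (C : TauModel L) : Prop :=
  C ∈ K.ofCard μ ∧ ∃ hAC : K.le A C,
    ∃ D ∈ K.ofCard μ, ∃ F ∈ K.ofCard μ, ∃ (hCD : K.le C D) (hCF : K.le C F)
      (fD : B → D) (fF : B → F),
      K.IsAmalgamation hAB hAC fD (incl hCD) ∧ K.IsAmalgamation hAB hAC fF (incl hCF) ∧
      ¬ K.EquivAmalgamation fD (incl hCD) fF (incl hCF) ∧
      tp hCD (fD b) = tp hCF (fF b) ∧ tp hCD (fD b) ∈ K.Sna C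

/-- `(A, B, b)` is a non-algebraic triple in `K_μ`: `A <_K B` are in `K_μ` and `b ∈ B \ A`. -/
def IsNonalgebraicTriple (μ : Cardinal.{u}) (A B : TauModel L) (b : ZFSet.{u}) : Prop :=
  A ∈ K.ofCard μ ∧ B ∈ K.ofCard μ ∧ K.lt A B ∧ b ∈ B.carrier ∧ b ∉ A.carrier

/-- `(A, B, b)` is a `*`-domination triple in `K_μ`. -/
def IsDominationTriple (μ : Cardinal.{u}) (A B : TauModel L) (b : ZFSet.{u}) : Prop :=
  K.IsNonalgebraicTriple μ A B b ∧
    ∀ (hAB : K.le A B) (hb : b ∈ B.carrier),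
      ¬ ∃ C, K.WitnessesNonDomination μ hAB ⟨b, hb⟩ C

end AEC

/-- `◇(κ)`: there is a sequence `⟨S α | α < κ⟩` with `S α ⊆ α` such that for every `X ⊆ κ` the set
of all `α < κ` with `X ∩ α = S α` is stationary in `κ`.  (Here `κ.ord.ToType` is the set of ordinals
below `κ`, and `Set.Iio α` is `α`.) -/
def Diamond (κ : Cardinal.{u}) : Prop :=
  ∃ S : κ.ord.ToType → Set κ.ord.ToType, (∀ α, S α ⊆ Set.Iio α) ∧
    ∀ X : Set κ.ord.ToType, IsStationary {α | X ∩ Set.Iio α = S α}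

-- Suppose that no triple above $(A,B,b)$ is a $*$-domination triple. Work with arrows: embeddings
-- `s.map` of `s.dom` into `s.cod`, both in $\mathbf K_\lambda$, ordered by extension, with $b$ in
-- `s.cod` but outside the range. Failure of domination at such an arrow $s$ yields two larger
-- arrows $s_0,s_1$ with the same domain that cannot be mapped into one model so as to agree both on
-- `s.cod` and on that domain (`exists_incompatible`). Iterating gives a binary tree of height
-- $\lambda^+$, to which a weak-diamond argument applies.
--
-- That argument needs all branches to have the same domain. When one node is split, every other
-- node of the level must be extended to the new domain without $b$ entering the range; above a
-- homogeneous arrow this is possible. Homogeneous arrows exist (`exists_homogeneous`): otherwise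
-- some $T$ cannot be extended to an arrow with some domain $C$, and a chain of $\lambda^+$ arrows
-- over $T$ adds at each step a new domain element that can be mapped to $b$. The domains are
-- amalgamated with $C$ along the way; as $|C|=\lambda$, some new element stays outside $C$. Mapping
-- it to $b$ keeps $b$ out of the image of $C$ and extends $T$ to $C$ after all.
--
-- In the tree (`exists_tree`) level $\delta$ is split only at the branch guessed by the diamond.
-- The unions of the branches are embeddings $M\to V_\eta$ with one fixed $M\in\mathbf
-- K_{\lambda^+}$. Stability and amalgamation in $\lambda^+$ give $N$ universal over $M$
-- (`exists_universal`), so every $V_\eta$ embeds into $N$ over $M$. The diamond guesses $\eta$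
-- together with such an embedding $h$. Let $\eta$ pass to $s_1$ at $\delta$ if the guessed map
-- lifts to $s_0$, and to $s_0$ otherwise. At a $\delta$ where $\eta$ and $h$ are guessed correctly,
-- the first case gives maps from $s_0$ and $s_1$ into $N$ contradicting incompatibility; in the
-- second, $h$ is the lift that was said not to exist.
--
-- Maps are taken as functions on all of `ZFSet`, so that restricting, gluing and comparing them
-- involves no change of type.

universe v

/-! ### Isomorphisms and renaming of models. -/

namespace TauModel

variable {L : FirstOrder.Language.{u, u}}

/-- The restriction of `f` to `A` is an isomorphism of `A` onto `B`. -/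
def IsoVia (A B : TauModel L) (f : ZFSet.{u} → ZFSet.{u}) : Prop :=
  ∃ e : A ≃[L] B, ∀ x : A, (e x : ZFSet.{u}) = f x

/-- Universes are actual sets, so an isomorphism that moves nothing is an equality. This turns
embeddings that fix a submodel pointwise into instances of `K.le`. -/
theorem eq_of_equiv {A B : TauModel L} (e : A ≃[L] B) (h : ∀ x : A, (e x : ZFSet.{u}) = x) :
    A = B := by
  have hc : A.carrier = B.carrier := by
    ext x
    constructor
    · intro hx
      have := (e ⟨x, hx⟩).2
      rwa [h] at this
    · intro hx
      have h1 := h (e.symm ⟨x, hx⟩)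
      rw [FirstOrder.Language.Equiv.apply_symm_apply] at h1
      have h2 := (e.symm ⟨x, hx⟩).2
      rwa [← h1] at h2
  obtain @⟨c, s⟩ := A
  obtain @⟨c', s'⟩ := B
  change c = c' at hc
  subst hc
  have he : ∀ x : {x // x ∈ c}, e x = x := fun x => Subtype.ext (h x)
  have : s = s' := by
    apply FirstOrder.Language.Structure.ext
    · funext n f x
      have h1 := @FirstOrder.Language.Equiv.map_fun L _ _ s s' e n f x
      have h2 : (e ∘ x) = x := funext fun i => he (x i)
      rw [h2] at h1
      exact (he _).symm.trans h1
    · funext n r x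
      have h1 := @FirstOrder.Language.Equiv.map_rel L _ _ s s' e n r x
      have h2 : (e ∘ x) = x := funext fun i => he (x i)
      rw [h2] at h1
      exact propext h1.symm
  subst this
  rfl

theorem exists_isoVia (A : TauModel L) (f : ZFSet.{u} → ZFSet.{u})
    (hf : Set.InjOn f {x | x ∈ A.carrier}) : ∃ B : TauModel L, A.IsoVia B f := by
  let Z : ZFSet.{u} := ZFSet.range (fun x : A => f x)
  let e : {x // x ∈ A.carrier} ≃ {x // x ∈ Z} := Equiv.ofBijective
    (fun x => ⟨f x, ZFSet.mem_range.2 ⟨x, rfl⟩⟩) (by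
      constructor
      · intro x y hxy
        exact Subtype.ext (hf x.2 y.2 (congrArg Subtype.val hxy))
      · rintro ⟨y, hy⟩
        obtain ⟨x, hx⟩ := ZFSet.mem_range.1 hy
        exact ⟨x, Subtype.ext hx⟩)
  refine ⟨@TauModel.mk L Z (@Equiv.inducedStructure L _ _ A.str e), ?_⟩
  exact ⟨@Equiv.inducedStructureEquiv L _ _ A.str e, fun x => rfl⟩

namespace IsoVia

variable {A B C : TauModel L} {f g : ZFSet.{u} → ZFSet.{u}}

theorem mem (h : A.IsoVia B f) {x : ZFSet.{u}} (hx : x ∈ A.carrier) : f x ∈ B.carrier := by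
  obtain ⟨e, he⟩ := h
  have := (e ⟨x, hx⟩).2
  rwa [he] at this

theorem injOn (h : A.IsoVia B f) : Set.InjOn f {x | x ∈ A.carrier} := by
  obtain ⟨e, he⟩ := h
  intro x hx y hy hxy
  have : e ⟨x, hx⟩ = e ⟨y, hy⟩ := Subtype.ext (by rw [he, he]; exact hxy)
  exact congrArg Subtype.val (e.injective this)

theorem surj (h : A.IsoVia B f) {y : ZFSet.{u}} (hy : y ∈ B.carrier) :
    ∃ x ∈ A.carrier, f x = y := by
  obtain ⟨e, he⟩ := h
  refine ⟨e.symm ⟨y, hy⟩, (e.symm ⟨y, hy⟩).2, ?_⟩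
  rw [← he, FirstOrder.Language.Equiv.apply_symm_apply]

theorem exists_inv (h : A.IsoVia B f) : ∃ g, B.IsoVia A g ∧ (∀ x ∈ A.carrier, g (f x) = x) ∧
    ∀ y ∈ B.carrier, f (g y) = y := by
  classical
  obtain ⟨e, he⟩ := h
  have key : ∀ y (hy : y ∈ B.carrier),
      (if hy : y ∈ B.carrier then (e.symm ⟨y, hy⟩ : ZFSet.{u}) else y) = e.symm ⟨y, hy⟩ :=
    fun y hy => dif_pos hy
  refine ⟨fun y => if hy : y ∈ B.carrier then e.symm ⟨y, hy⟩ else y,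
    ⟨e.symm, fun x => (key x.1 x.2).symm⟩, fun x hx => ?_, fun y hy => ?_⟩
  · have hfx : f x ∈ B.carrier := mem ⟨e, he⟩ hx
    have h1 : (⟨f x, hfx⟩ : B) = e ⟨x, hx⟩ := Subtype.ext (he ⟨x, hx⟩).symm
    beta_reduce
    rw [key _ hfx, h1, FirstOrder.Language.Equiv.symm_apply_apply]
  · beta_reduce
    rw [key _ hy, ← he, FirstOrder.Language.Equiv.apply_symm_apply]

theorem comp (h : A.IsoVia B f) (h' : B.IsoVia C g) : A.IsoVia C (g ∘ f) := by
  obtain ⟨e, he⟩ := h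
  obtain ⟨e', he'⟩ := h'
  refine ⟨e'.comp e, fun x => ?_⟩
  rw [FirstOrder.Language.Equiv.comp_apply, he', he]
  rfl

theorem card_eq (h : A.IsoVia B f) : A.card = B.card := by
  obtain ⟨e, -⟩ := h
  have : #A.carrier = #B.carrier := Cardinal.mk_congr e.toEquiv
  rw [ZFSet.cardinalMk_coe_sort, ZFSet.cardinalMk_coe_sort] at this
  exact Cardinal.lift_injective this

end IsoVia

/-- Renaming the elements of `B` so that a given injection of a set into `B` becomes the
inclusion. -/
theorem exists_rename (X : ZFSet.{u}) (B : TauModel L) (f : ZFSet.{u} → ZFSet.{u})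
    (hf : Set.InjOn f {x | x ∈ X}) :
    ∃ B' r, B.IsoVia B' r ∧ ∀ x ∈ X, r (f x) = x := by
  classical
  -- Elements outside the image of `X` are renamed to `pair X y`, whose rank exceeds that of `X`;
  -- they cannot collide with elements of `X`.
  have hpair : ∀ y, ZFSet.pair X y ∉ X := by
    intro y hy
    have h1 : ({X} : ZFSet.{u}) ∈ ZFSet.pair X y := by
      rw [ZFSet.pair]; exact ZFSet.mem_pair.2 (Or.inl rfl)
    have h2 : X ∈ ({X} : ZFSet.{u}) := ZFSet.mem_singleton.2 rfl
    have h3 := ZFSet.rank_lt_of_mem hy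
    have h4 := ZFSet.rank_lt_of_mem h1
    have h5 := ZFSet.rank_lt_of_mem h2
    exact lt_irrefl _ ((h5.trans h4).trans h3)
  let r : ZFSet.{u} → ZFSet.{u} := fun y =>
    if h : ∃ x ∈ X, f x = y then h.choose else ZFSet.pair X y
  have hr : ∀ x ∈ X, r (f x) = x := by
    intro x hx
    have h : ∃ x' ∈ X, f x' = f x := ⟨x, hx, rfl⟩
    have : r (f x) = h.choose := dif_pos h
    rw [this]
    exact hf h.choose_spec.1 hx h.choose_spec.2
  have hr' : ∀ y, (¬ ∃ x ∈ X, f x = y) → r y = ZFSet.pair X y := fun y h => dif_neg h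
  obtain ⟨B', hB'⟩ := B.exists_isoVia r (by
    intro y _ z _ hyz
    by_cases h1 : ∃ x ∈ X, f x = y <;> by_cases h2 : ∃ x ∈ X, f x = z
    · obtain ⟨x, hx, rfl⟩ := h1
      obtain ⟨x', hx', rfl⟩ := h2
      rw [hr x hx, hr x' hx'] at hyz
      rw [hyz]
    · obtain ⟨x, hx, rfl⟩ := h1
      rw [hr x hx, hr' z h2] at hyz
      exact absurd (hyz ▸ hx) (hpair z)
    · obtain ⟨x, hx, rfl⟩ := h2
      rw [hr x hx, hr' y h1] at hyz
      exact absurd (hyz ▸ hx) (hpair y)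
    · rw [hr' y h1, hr' z h2] at hyz
      exact (ZFSet.pair_injective hyz).2)
  exact ⟨B', r, hB', hr⟩

end TauModel

/-! ### Embeddings in an abstract elementary class. -/

namespace AEC

variable {L : FirstOrder.Language.{u, u}} (K : AEC L)

/-- The restriction of `f` to `A` is a `K`-embedding of `A` into `B`. -/
def Emb (A B : TauModel L) (f : ZFSet.{u} → ZFSet.{u}) : Prop :=
  ∃ A', K.le A' B ∧ A.IsoVia A' f

variable {K}

theorem le_of_isoVia {A B C A' : TauModel L} {f : ZFSet.{u} → ZFSet.{u}} (hBC : B.IsoVia C f)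
    (hAB : K.le A B) (hA : A.IsoVia A' f) : K.le A' C := by
  obtain ⟨φ, hφ⟩ := hBC
  obtain ⟨ψ, hψ⟩ := hA
  exact K.le_of_equiv φ (K.submodel hAB) hAB ⟨ψ, fun x => by rw [hψ, hφ]⟩

theorem mem_of_isoVia {A B : TauModel L} {f : ZFSet.{u} → ZFSet.{u}} (h : A.IsoVia B f)
    (hA : A ∈ K.mem) : B ∈ K.mem := by
  obtain ⟨φ, -⟩ := h
  exact K.mem_of_equiv φ hA

theorem le_subset {A B : TauModel L} (h : K.le A B) {x : ZFSet.{u}} (hx : x ∈ A.carrier) :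
    x ∈ B.carrier := (K.submodel h).subset hx

theorem le_card {A B : TauModel L} (h : K.le A B) : A.card ≤ B.card :=
  ZFSet.card_mono (K.submodel h).subset

theorem emb_of_isoVia {A B : TauModel L} {f : ZFSet.{u} → ZFSet.{u}} (h : A.IsoVia B f)
    (hA : A ∈ K.mem) : K.Emb A B f :=
  ⟨B, K.refl (mem_of_isoVia h hA), h⟩

theorem emb_of_le {A B : TauModel L} (h : K.le A B) : K.Emb A B id :=
  ⟨A, h, FirstOrder.Language.Equiv.refl L A, fun _ => rfl⟩

namespace Emb

variable {A B C D : TauModel L} {f g : ZFSet.{u} → ZFSet.{u}}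

theorem congr (h : K.Emb A B f) (hfg : ∀ x ∈ A.carrier, g x = f x) : K.Emb A B g := by
  obtain ⟨A', hA', e, he⟩ := h
  exact ⟨A', hA', e, fun x => by rw [he, hfg _ x.2]⟩

theorem mem_right (h : K.Emb A B f) : B ∈ K.mem := by
  obtain ⟨A', hA', -⟩ := h
  exact (K.le_mem hA').2

theorem mem_left (h : K.Emb A B f) : A ∈ K.mem := by
  obtain ⟨A', hA', e, -⟩ := h
  exact K.mem_of_equiv e.symm (K.le_mem hA').1

theorem map_mem (h : K.Emb A B f) {x : ZFSet.{u}} (hx : x ∈ A.carrier) : f x ∈ B.carrier := by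
  obtain ⟨A', hA', e⟩ := h
  exact le_subset hA' (e.mem hx)

theorem injOn (h : K.Emb A B f) : Set.InjOn f {x | x ∈ A.carrier} := by
  obtain ⟨A', hA', e⟩ := h
  exact e.injOn

theorem inj (h : K.Emb A B f) {x y : ZFSet.{u}} (hx : x ∈ A.carrier) (hy : y ∈ A.carrier)
    (hxy : f x = f y) : x = y := h.injOn hx hy hxy

theorem card_le (h : K.Emb A B f) : A.card ≤ B.card := by
  obtain ⟨A', hA', e⟩ := h
  rw [e.card_eq]
  exact le_card hA'

theorem le (h : K.Emb A B f) (hf : ∀ x ∈ A.carrier, f x = x) : K.le A B := by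
  obtain ⟨A', hA', e, he⟩ := h
  have : A = A' := TauModel.eq_of_equiv e fun x => by rw [he, hf _ x.2]
  rwa [this]

theorem comp (h : K.Emb A B f) (h' : K.Emb B C g) : K.Emb A C (g ∘ f) := by
  obtain ⟨A', hA', e⟩ := h
  obtain ⟨B', hB', e'⟩ := h'
  obtain ⟨A'', e''⟩ := A'.exists_isoVia g
    (e'.injOn.mono fun x hx => le_subset hA' hx)
  exact ⟨A'', K.trans (le_of_isoVia e' hA' e'') hB', e.comp e''⟩

theorem restrict (h : K.Emb B C f) (hAB : K.le A B) : K.Emb A C f :=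
  (emb_of_le hAB).comp h

theorem trans_le (h : K.Emb A B f) (hBC : K.le B C) : K.Emb A C f :=
  h.comp (emb_of_le hBC)

/-- Coherence for embeddings. -/
theorem of_subset (h : K.Emb A C f) (hBC : K.le B C) (hf : ∀ x ∈ A.carrier, f x ∈ B.carrier) :
    K.Emb A B f := by
  obtain ⟨A', hA', e⟩ := h
  refine ⟨A', K.coherence (K.le_mem hA').1 (K.le_mem hBC).1 (K.le_mem hBC).2 ?_ (K.submodel hBC)
    hA' hBC, e⟩
  have hsub : ∀ x ∈ A'.carrier, x ∈ B.carrier := by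
    intro x hx
    obtain ⟨y, hy, rfl⟩ := e.surj hx
    exact hf y hy
  obtain ⟨i, hi⟩ := K.submodel hA'
  obtain ⟨j, hj⟩ := K.submodel hBC
  have key : ∀ x : A', j ⟨x, hsub x x.2⟩ = i x := fun x => Subtype.ext (by rw [hi, hj])
  refine ⟨⟨⟨fun x => ⟨x, hsub x x.2⟩, fun x y hxy => ?_⟩, ?_, ?_⟩, fun x => rfl⟩
  · have := congrArg Subtype.val hxy
    exact Subtype.ext this
  · intro n F x
    apply j.injective
    beta_reduce
    rw [key, i.map_fun, j.map_fun]
    congr 1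
    funext k
    exact (key (x k)).symm
  · intro n R x
    rw [← j.map_rel, ← i.map_rel]
    have : (j ∘ (fun x : A' => (⟨x, hsub x x.2⟩ : B)) ∘ x) = i ∘ x := funext fun k => key (x k)
    exact iff_of_eq (congrArg _ this)

/-- A model into which `A` embeds is isomorphic over `A` to a strong extension of `A`. -/
theorem exists_extension (h : K.Emb A B f) :
    ∃ B' r, B.IsoVia B' r ∧ K.le A B' ∧ ∀ x ∈ A.carrier, r (f x) = x := by
  obtain ⟨B', r, hB', hr⟩ := TauModel.exists_rename A.carrier B f h.injOn
  exact ⟨B', r, hB', (h.comp (emb_of_isoVia hB' h.mem_right)).le hr, hr⟩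

end Emb

theorem mem_ofCard_of_isoVia {A B : TauModel L} {f : ZFSet.{u} → ZFSet.{u}} {μ : Cardinal.{u}}
    (h : A.IsoVia B f) (hA : A ∈ K.ofCard μ) : B ∈ K.ofCard μ :=
  ⟨mem_of_isoVia h hA.1, h.card_eq ▸ hA.2⟩

open Classical in
/-- The extension of a function between models to the class of all sets. -/
noncomputable def extend {A B : TauModel L} (f : A → B) : ZFSet.{u} → ZFSet.{u} :=
  fun x => if h : x ∈ A.carrier then f ⟨x, h⟩ else x

theorem extend_apply {A B : TauModel L} (f : A → B) (x : A) : extend f x = f x :=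
  dif_pos x.2

theorem extend_of_mem {A B : TauModel L} (f : A → B) {x : ZFSet.{u}} (hx : x ∈ A.carrier) :
    extend f x = f ⟨x, hx⟩ :=
  dif_pos hx

theorem IsEmbedding.emb {A B : TauModel L} {f : A → B} (h : K.IsEmbedding f) :
    K.Emb A B (extend f) := by
  obtain ⟨-, -, A', hA', ψ, hψ⟩ := h
  exact ⟨A', hA', ψ, fun x => by rw [hψ, extend_apply]⟩

theorem Emb.isEmbedding {A B : TauModel L} {f : ZFSet.{u} → ZFSet.{u}} (h : K.Emb A B f) :
    K.IsEmbedding (fun x : A => (⟨f x, h.map_mem x.2⟩ : B)) := by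
  refine ⟨h.mem_left, h.mem_right, ?_⟩
  obtain ⟨A', hA', ψ, hψ⟩ := h
  exact ⟨A', hA', ψ, hψ⟩

/-- Renaming turns the given embeddings into inclusions before amalgamating, and turns the first map
of the amalgam into an inclusion afterwards, so that chains of codomains are literally increasing.
-/
theorem AmalgamationProperty.exists_emb {μ : Cardinal.{u}} (hAP : K.AmalgamationProperty μ)
    {A B C : TauModel L} (hA : A ∈ K.ofCard μ) (hB : B ∈ K.ofCard μ) (hC : C ∈ K.ofCard μ)
    {f g : ZFSet.{u} → ZFSet.{u}} (hf : K.Emb A B f) (hg : K.Emb A C g) :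
    ∃ D ∈ K.ofCard μ, K.le B D ∧ ∃ h, K.Emb C D h ∧ ∀ x ∈ A.carrier, h (g x) = f x := by
  obtain ⟨B1, r1, hr1, hAB1, h1⟩ := hf.exists_extension
  obtain ⟨C1, r2, hr2, hAC1, h2⟩ := hg.exists_extension
  obtain ⟨D, hD, fB, fC, hfB, hfC, hBC⟩ := hAP A hA B1 (mem_ofCard_of_isoVia hr1 hB) C1
    (mem_ofCard_of_isoVia hr2 hC) hAB1 hAC1
  have hBD := (emb_of_isoVia hr1 hB.1).comp hfB.emb
  obtain ⟨D', r3, hr3, hBD', h3⟩ := hBD.exists_extension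
  refine ⟨D', mem_ofCard_of_isoVia hr3 hD, hBD', _,
    ((emb_of_isoVia hr2 hC.1).comp hfC.emb).comp (emb_of_isoVia hr3 hD.1), fun x hx => ?_⟩
  have e1 := hBC ⟨x, hx⟩
  have e2 : extend fB x = extend fC x := by
    rw [extend_of_mem _ (le_subset hAB1 hx), extend_of_mem _ (le_subset hAC1 hx)]
    exact congrArg Subtype.val e1
  have e3 := h3 (f x) (hf.map_mem hx)
  simp only [Function.comp_apply] at e3 ⊢
  rw [h1 x hx, e2] at e3
  rw [h2 x hx, e3]

theorem isLSTCardinal_LST : IsLSTCardinal K.mem K.le K.LST :=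
  csInf_mem K.exists_isLSTCardinal

/-- The Löwenheim–Skolem theorem over a model of cardinality `μ`. -/
theorem exists_le_of_LST {μ : Cardinal.{u}} (hLST : K.LST ≤ μ) {N : TauModel L} (hN : N ∈ K.mem)
    {Z : ZFSet.{u}} (hZ : Z ⊆ N.carrier) (hZμ : Z.card = μ) :
    ∃ M ∈ K.ofCard μ, K.le M N ∧ Z ⊆ M.carrier := by
  obtain ⟨M, hM, hMN, hc, hZM⟩ := isLSTCardinal_LST.2.2 N hN Z hZ
  refine ⟨M, ⟨hM, le_antisymm (hc.trans ?_) ?_⟩, hMN, hZM⟩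
  · exact max_le hLST hZμ.le
  · rw [← hZμ]
    exact ZFSet.card_mono hZM

end AEC

/-! ### Unions of chains of structures. -/

namespace TauModel

variable {L : FirstOrder.Language.{u, u}}

open FirstOrder.Language.Structure in
theorem Submodel.funMap_eq {A B : TauModel L} (h : A.Submodel B) {n : ℕ} (F : L.Functions n)
    (x : Fin n → A) (y : Fin n → B) (hxy : ∀ i, (x i : ZFSet.{u}) = y i) :
    ((funMap F x : A) : ZFSet.{u}) = (funMap F y : B) := by
  obtain ⟨i, hi⟩ := h
  have : y = i ∘ x := funext fun k => Subtype.ext (by rw [Function.comp_apply, hi, hxy])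
  rw [this, ← i.map_fun, hi]

open FirstOrder.Language.Structure in
theorem Submodel.relMap_iff {A B : TauModel L} (h : A.Submodel B) {n : ℕ} (R : L.Relations n)
    (x : Fin n → A) (y : Fin n → B) (hxy : ∀ i, (x i : ZFSet.{u}) = y i) :
    RelMap R x ↔ RelMap R y := by
  obtain ⟨i, hi⟩ := h
  have : y = i ∘ x := funext fun k => Subtype.ext (by rw [Function.comp_apply, hi, hxy])
  rw [this, i.map_rel]

theorem exists_bound {δ : Ordinal.{u}} (hδ : 0 < δ) {A : Ordinal.{u} → TauModel L}
    (hA : ∀ α β, α ≤ β → β < δ → (A α).Submodel (A β)) {n : ℕ} (x : Fin n → ZFSet.{u})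
    (hx : ∀ i, ∃ α < δ, x i ∈ (A α).carrier) : ∃ α < δ, ∀ i, x i ∈ (A α).carrier := by
  choose a ha hxa using hx
  rcases Nat.eq_zero_or_pos n with rfl | hn
  · exact ⟨0, hδ, fun i => i.elim0⟩
  · have hne : (Finset.univ : Finset (Fin n)).Nonempty := ⟨⟨0, hn⟩, Finset.mem_univ _⟩
    obtain ⟨j, -, hj⟩ := Finset.exists_max_image Finset.univ a hne
    exact ⟨a j, ha j, fun i => (hA _ _ (hj i (Finset.mem_univ _)) (ha j)).subset (hxa i)⟩

-- Symbols are finitary, so functions and relations on the union are evaluated at a stage containing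
-- all arguments; the submodel relation makes the value independent of the stage.
open FirstOrder.Language.Structure in
theorem exists_isUnion {δ : Ordinal.{u}} (hδ : 0 < δ) {A : Ordinal.{u} → TauModel L}
    (hA : ∀ α β, α ≤ β → β < δ → (A α).Submodel (A β)) : ∃ U, IsUnion δ A U := by
  classical
  let Z : ZFSet.{u} := ZFSet.iUnion (fun i : Set.Iio δ => (A i).carrier)
  have hZ : ∀ x, x ∈ Z ↔ ∃ α < δ, x ∈ (A α).carrier := by
    intro x
    rw [ZFSet.mem_iUnion]
    exact ⟨fun ⟨i, hi⟩ => ⟨i, i.2, hi⟩, fun ⟨α, h, hx⟩ => ⟨⟨α, h⟩, hx⟩⟩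
  have hb : ∀ {n : ℕ} (x : Fin n → {x // x ∈ Z}), ∃ α < δ, ∀ i, (x i : ZFSet.{u}) ∈ (A α).carrier :=
    fun x => exists_bound hδ hA (fun i => (x i : ZFSet.{u})) fun i => (hZ _).1 (x i).2
  let b : ∀ {n : ℕ} (x : Fin n → {x // x ∈ Z}), Ordinal.{u} := fun x => (hb x).choose
  have hbδ : ∀ {n : ℕ} (x : Fin n → {x // x ∈ Z}), b x < δ := fun x => (hb x).choose_spec.1
  have hbm : ∀ {n : ℕ} (x : Fin n → {x // x ∈ Z}) i, (x i : ZFSet.{u}) ∈ (A (b x)).carrier :=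
    fun x => (hb x).choose_spec.2
  let s : L.Structure {x // x ∈ Z} :=
    { funMap := fun {n} F x => ⟨funMap (M := A (b x)) F fun i => ⟨x i, hbm x i⟩,
        (hZ _).2 ⟨_, hbδ x, Subtype.property _⟩⟩
      RelMap := fun {n} R x => RelMap (M := A (b x)) R fun i => ⟨x i, hbm x i⟩ }
  refine ⟨@TauModel.mk L Z s, hZ, fun α hα => ?_⟩
  have hsub : ∀ x : A α, (x : ZFSet.{u}) ∈ Z := fun x => (hZ _).2 ⟨α, hα, x.2⟩
  refine ⟨⟨⟨fun x => ⟨x, hsub x⟩, fun x y hxy => ?_⟩, ?_, ?_⟩, fun x => rfl⟩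
  · have := congrArg Subtype.val hxy
    exact Subtype.ext this
  · intro n F x
    apply Subtype.ext
    rcases le_total α (b fun i => (⟨x i, hsub (x i)⟩ : {x // x ∈ Z})) with h | h
    · exact (hA _ _ h (hbδ _)).funMap_eq F x
        (fun i => ⟨x i, hbm (fun i => (⟨x i, hsub (x i)⟩ : {x // x ∈ Z})) i⟩) fun i => rfl
    · exact ((hA _ _ h hα).funMap_eq F
        (fun i => ⟨x i, hbm (fun i => (⟨x i, hsub (x i)⟩ : {x // x ∈ Z})) i⟩) x fun i => rfl).symm
  · intro n R x
    rcases le_total α (b fun i => (⟨x i, hsub (x i)⟩ : {x // x ∈ Z})) with h | h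
    · exact ((hA _ _ h (hbδ _)).relMap_iff R x
        (fun i => ⟨x i, hbm (fun i => (⟨x i, hsub (x i)⟩ : {x // x ∈ Z})) i⟩) fun i => rfl).symm
    · exact (hA _ _ h hα).relMap_iff R
        (fun i => ⟨x i, hbm (fun i => (⟨x i, hsub (x i)⟩ : {x // x ∈ Z})) i⟩) x fun i => rfl

theorem IsUnion.congr {δ : Ordinal.{u}} {A B : Ordinal.{u} → TauModel L} {U : TauModel L}
    (h : IsUnion δ A U) (hAB : ∀ α < δ, A α = B α) : IsUnion δ B U := by
  refine ⟨fun x => (h.1 x).trans ⟨?_, ?_⟩, fun α hα => hAB α hα ▸ h.2 α hα⟩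
  · rintro ⟨α, hα, hx⟩
    exact ⟨α, hα, hAB α hα ▸ hx⟩
  · rintro ⟨α, hα, hx⟩
    exact ⟨α, hα, (hAB α hα).symm ▸ hx⟩

theorem IsUnion.card_le {δ : Ordinal.{u}} {A : Ordinal.{u} → TauModel L} {U : TauModel L}
    (h : IsUnion δ A U) {μ : Cardinal.{u}} (hμ : ℵ₀ ≤ μ) (hδ : δ.card ≤ μ)
    (hA : ∀ α < δ, (A α).card ≤ μ) : U.card ≤ μ := by
  let e := (Ordinal.ToType.mk (o := δ))
  have hsub : U.carrier ⊆ ZFSet.iUnion (fun i : δ.ToType => (A (e.symm i)).carrier) := by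
    intro x hx
    obtain ⟨α, hα, hxα⟩ := (h.1 x).1 hx
    refine ZFSet.mem_iUnion.2 ⟨e ⟨α, hα⟩, ?_⟩
    rwa [OrderIso.symm_apply_apply]
  refine (ZFSet.card_mono hsub).trans ?_
  have h1 := ZFSet.lift_card_iUnion_le_sum_card (f := fun i : δ.ToType => (A (e.symm i)).carrier)
  rw [Cardinal.lift_id] at h1
  refine h1.trans ((Cardinal.sum_le_sum _ (fun _ => μ) fun i => hA _ (e.symm i).2).trans ?_)
  rw [Cardinal.sum_const', Cardinal.mk_toType]
  exact Cardinal.mul_le_of_le hμ hδ le_rfl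

end TauModel

/-! ### Continuous chains in the class, and maps on their unions. -/

namespace AEC

variable {L : FirstOrder.Language.{u, u}} (K : AEC L)

/-- `A` restricted to the ordinals below `δ` is an increasing continuous sequence. -/
structure IsChain (δ : Ordinal.{u}) (A : Ordinal.{u} → TauModel L) : Prop where
  mono : ∀ α β, α ≤ β → β < δ → K.le (A α) (A β)
  cont : ∀ γ < δ, Order.IsSuccLimit γ → TauModel.IsUnion γ A (A γ)

variable {K}

namespace IsChain

variable {δ : Ordinal.{u}} {A C D : Ordinal.{u} → TauModel L} {U V N : TauModel L}

theorem exists_isUnion (h : K.IsChain δ A) (hδ : 0 < δ) : ∃ U, TauModel.IsUnion δ A U :=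
  TauModel.exists_isUnion hδ fun α β hαβ hβ => K.submodel (h.mono α β hαβ hβ)

theorem le_union (h : K.IsChain δ A) (hU : TauModel.IsUnion δ A U) {α : Ordinal.{u}} (hα : α < δ) :
    K.le (A α) U :=
  (K.union δ A U (pos_of_gt hα) (fun β hβ => (K.le_mem (h.mono β β le_rfl hβ)).1)
    h.mono hU).2 α hα

theorem exists_common (h : K.IsChain δ A) (hU : TauModel.IsUnion δ A U) {x y : ZFSet.{u}}
    (hx : x ∈ U.carrier) (hy : y ∈ U.carrier) :
    ∃ α < δ, x ∈ (A α).carrier ∧ y ∈ (A α).carrier := by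
  obtain ⟨α, hα, hxα⟩ := (hU.1 x).1 hx
  obtain ⟨β, hβ, hyβ⟩ := (hU.1 y).1 hy
  rcases le_total α β with hab | hab
  · exact ⟨β, hβ, le_subset (h.mono _ _ hab hβ) hxα, hyβ⟩
  · exact ⟨α, hα, hxα, le_subset (h.mono _ _ hab hα) hyβ⟩

theorem union_le (h : K.IsChain δ A) (hδ : Order.IsSuccLimit δ) (hU : TauModel.IsUnion δ A U)
    (hN : ∀ α < δ, K.le (A α) N) : K.le U N := by
  classical
  have h0 : (0 : Ordinal.{u}) < δ := hδ.bot_lt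
  -- The smoothness axiom speaks of sequences indexed up to and including `δ`, so `U` is appended as
  -- the last term.
  obtain ⟨B, hlt, hge⟩ : ∃ B : Ordinal.{u} → TauModel L, (∀ {α}, α < δ → B α = A α) ∧ B δ = U :=
    ⟨fun α => if α < δ then A α else U, fun hα => if_pos hα, if_neg (lt_irrefl δ)⟩
  have hUm : U ∈ K.mem := (K.le_mem (h.le_union hU h0)).2
  have := K.smooth δ B N hδ ?_ ?_ ?_ (K.le_mem (hN 0 h0)).2 ?_
  · rwa [hge] at this
  · intro α hα
    rcases hα.lt_or_eq with hα | rfl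
    · rw [hlt hα]
      exact (K.le_mem (hN α hα)).1
    · rwa [hge]
  · intro α β hαβ hβ
    rcases hβ.lt_or_eq with hβ | rfl
    · rw [hlt hβ, hlt (hαβ.trans_lt hβ)]
      exact h.mono _ _ hαβ hβ
    · rw [hge]
      rcases hαβ.lt_or_eq with hα | rfl
      · rw [hlt hα]
        exact h.le_union hU hα
      · rw [hge]
        exact K.refl hUm
  · intro γ hγ hlim
    rcases hγ.lt_or_eq with hγ | rfl
    · rw [hlt hγ]
      exact (h.cont γ hγ hlim).congr fun α hα => (hlt (hα.trans hγ)).symm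
    · rw [hge]
      exact hU.congr fun α hα => (hlt hα).symm
  · intro α hα
    rw [hlt hα]
    exact hN α hα

/-- Renaming `N` along `f` turns all the restrictions of `f` into inclusions, which reduces the
claim to smoothness. -/
theorem union_emb (h : K.IsChain δ A) (hδ : Order.IsSuccLimit δ) (hU : TauModel.IsUnion δ A U)
    {f : ZFSet.{u} → ZFSet.{u}} (hf : ∀ α < δ, K.Emb (A α) N f) : K.Emb U N f := by
  have h0 : (0 : Ordinal.{u}) < δ := hδ.bot_lt
  have hinj : Set.InjOn f {x | x ∈ U.carrier} := by
    intro x hx y hy hxy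
    obtain ⟨α, hα, hxα, hyα⟩ := h.exists_common hU hx hy
    exact (hf α hα).inj hxα hyα hxy
  obtain ⟨N', r, hr, hrf⟩ := TauModel.exists_rename U.carrier N f hinj
  have hNm := (hf 0 h0).mem_right
  have hUN' : K.le U N' := h.union_le hδ hU fun α hα =>
    ((hf α hα).comp (emb_of_isoVia hr hNm)).le
      fun x hx => hrf x (le_subset (h.le_union hU hα) hx)
  obtain ⟨s, hs, hs1, -⟩ := hr.exists_inv
  refine ((emb_of_isoVia hs (mem_of_isoVia hr hNm)).restrict hUN').congr fun x hx => ?_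
  obtain ⟨α, hα, hxα⟩ := (hU.1 x).1 hx
  rw [← hs1 (f x) ((hf α hα).map_mem hxα), hrf x hx]

/-- The union of a chain of embeddings is an embedding. -/
theorem union_emb_union (hC : K.IsChain δ C) (hD : K.IsChain δ D) (hδ : Order.IsSuccLimit δ)
    (hU : TauModel.IsUnion δ C U) (hV : TauModel.IsUnion δ D V)
    {g : Ordinal.{u} → ZFSet.{u} → ZFSet.{u}} (hg : ∀ α < δ, K.Emb (C α) (D α) (g α))
    {f : ZFSet.{u} → ZFSet.{u}} (hf : ∀ α < δ, ∀ x ∈ (C α).carrier, f x = g α x) :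
    K.Emb U V f :=
  hC.union_emb hδ hU fun α hα => ((hg α hα).trans_le (hD.le_union hV hα)).congr (hf α hα)

theorem card_union (h : K.IsChain δ A) (hδ0 : 0 < δ) (hU : TauModel.IsUnion δ A U)
    {μ : Cardinal.{u}} (hμ : ℵ₀ ≤ μ) (hδ : δ.card ≤ μ) (hA : ∀ α < δ, A α ∈ K.ofCard μ) :
    U ∈ K.ofCard μ :=
  ⟨(K.le_mem (h.le_union hU hδ0)).2, le_antisymm (hU.card_le hμ hδ fun α hα => (hA α hα).2.le)
    ((hA 0 hδ0).2 ▸ le_card (h.le_union hU hδ0))⟩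

end IsChain

/-- Gluing of a coherent family of functions. -/
theorem exists_glue {δ : Ordinal.{u}} {C : Ordinal.{u} → TauModel L}
    {g : Ordinal.{u} → ZFSet.{u} → ZFSet.{u}}
    (hg : ∀ α β, α ≤ β → β < δ → ∀ x ∈ (C α).carrier, g β x = g α x) :
    ∃ f : ZFSet.{u} → ZFSet.{u}, ∀ α < δ, ∀ x ∈ (C α).carrier, f x = g α x := by
  classical
  refine ⟨fun x => if h : ∃ α < δ, x ∈ (C α).carrier then g h.choose x else x, ?_⟩
  intro α hα x hx
  have h : ∃ α < δ, x ∈ (C α).carrier := ⟨α, hα, hx⟩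
  have h1 := h.choose_spec
  beta_reduce
  rw [dif_pos h]
  rcases le_total α h.choose with hab | hab
  · exact hg _ _ hab h1.1 x hx
  · exact (hg _ _ hab hα x h1.2).symm

end AEC

/-! ### Transfinite recursion with invariants. -/

/-- Construction of a sequence by transfinite recursion, where every stage satisfies `P`, later
stages extend earlier ones in the sense of `R`, successive stages are related by `Q`, and limit
stages are related to the previous ones by `Lim`. -/
theorem exists_transfinite_sequence {S : Type v} (κ : Ordinal.{u}) (P : Ordinal.{u} → S → Prop)
    (R : S → S → Prop) (Q : Ordinal.{u} → S → S → Prop)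
    (Lim : Ordinal.{u} → (Ordinal.{u} → S) → S → Prop)
    (hrefl : ∀ α s, P α s → R s s) (htrans : ∀ s t r, R s t → R t r → R s r)
    (hcongr : ∀ δ f g s, (∀ α < δ, f α = g α) → Lim δ f s → Lim δ g s)
    (s₀ : S) (h₀ : P 0 s₀)
    (hsucc : ∀ α, α + 1 < κ → ∀ s, P α s → ∃ s', P (α + 1) s' ∧ R s s' ∧ Q α s s')
    (hlim : ∀ δ < κ, Order.IsSuccLimit δ → ∀ f : Ordinal.{u} → S, (∀ α < δ, P α (f α)) →
      (∀ α β, α ≤ β → β < δ → R (f α) (f β)) →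
      (∀ γ < δ, Order.IsSuccLimit γ → Lim γ f (f γ)) →
      ∃ s, P δ s ∧ (∀ α < δ, R (f α) s) ∧ Lim δ f s) :
    ∃ f : Ordinal.{u} → S, f 0 = s₀ ∧ (∀ α < κ, P α (f α)) ∧
      (∀ α β, α ≤ β → β < κ → R (f α) (f β)) ∧
      (∀ α, α + 1 < κ → Q α (f α) (f (α + 1))) ∧
      ∀ γ < κ, Order.IsSuccLimit γ → Lim γ f (f γ) := by
  classical
  -- Histories are made total by the junk value `s₀`; `hcongr` allows `Lim` to be transferred
  -- between such a history and the sequence itself.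
  let ext : ∀ α : Ordinal.{u}, (∀ β, β < α → S) → Ordinal.{u} → S :=
    fun α F β => if h : β < α then F β h else s₀
  let next : ∀ α : Ordinal.{u}, (Ordinal.{u} → S) → S := fun α g =>
    if α = 0 then s₀ else
    if h : ∃ s β, α = β + 1 ∧ P α s ∧ R (g β) s ∧ Q β (g β) s then h.choose else
    if h : ∃ s, P α s ∧ (∀ β < α, R (g β) s) ∧ Lim α g s then h.choose else s₀
  let f : Ordinal.{u} → S := WellFoundedLT.fix fun α F => next α (ext α F)
  have hf : ∀ α, f α = next α (fun β => if β < α then f β else s₀) := by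
    intro α
    have h1 : f α = next α (ext α fun β _ => f β) := WellFoundedLT.fix_eq _ α
    rw [h1]
    congr 1
  have f0 : f 0 = s₀ := by
    rw [hf]
    exact if_pos rfl
  have main : ∀ α < κ, P α (f α) ∧ (∀ β ≤ α, R (f β) (f α)) ∧
      (∀ β, α = β + 1 → Q β (f β) (f α)) ∧ (Order.IsSuccLimit α → Lim α f (f α)) := by
    intro α
    induction α using WellFoundedLT.induction with
    | ind α ih =>
    intro hα
    have hle : ∀ {α}, P α (f α) → (∀ β < α, R (f β) (f α)) → ∀ β ≤ α, R (f β) (f α) := by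
      intro α hP hlt β hβ
      rcases hβ.lt_or_eq with hβ | rfl
      · exact hlt β hβ
      · exact hrefl _ _ hP
    rcases Ordinal.zero_or_succ_or_isSuccLimit α with rfl | ⟨β, rfl⟩ | hlimit
    · have hP : P 0 (f 0) := by rwa [f0]
      refine ⟨hP, hle hP fun β hβ => absurd hβ (not_lt_bot), fun β hβ => ?_, fun h => ?_⟩
      · have h : β < β + 1 := Order.lt_add_one_iff.2 le_rfl
        rw [← hβ] at h
        exact absurd h not_lt_bot
      · exact absurd rfl h.ne_bot
    · rw [Order.succ_eq_add_one] at *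
      have hβ : β < β + 1 := by rw [← Order.succ_eq_add_one]; exact Order.lt_succ β
      obtain ⟨hPβ, hRβ, -, -⟩ := ih β hβ (hβ.trans hα)
      obtain ⟨s', hs'⟩ := hsucc β hα (f β) hPβ
      have hex : ∃ s γ, β + 1 = γ + 1 ∧ P (β + 1) s ∧
          R ((fun β' => if β' < β + 1 then f β' else s₀) γ) s ∧
          Q γ ((fun β' => if β' < β + 1 then f β' else s₀) γ) s := by
        refine ⟨s', β, rfl, hs'.1, ?_⟩
        simpa only [if_pos hβ] using hs'.2
      have hfe : f (β + 1) = hex.choose := by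
        rw [hf]
        exact (if_neg (by simp)).trans (dif_pos hex)
      obtain ⟨γ, hγ, h1, h2, h3⟩ := hex.choose_spec
      obtain rfl : β = γ := by simpa using hγ
      rw [← hfe] at h1 h2 h3
      simp only [if_pos hβ] at h2 h3
      refine ⟨h1, hle h1 fun γ hγ => htrans _ _ _ (hRβ γ ?_) h2, fun γ hγ => ?_, fun h => ?_⟩
      · rwa [← Order.succ_eq_add_one, Order.lt_succ_iff] at hγ
      · obtain rfl : β = γ := by simpa using hγ
        exact h3
      · rw [← Order.succ_eq_add_one] at h
        exact absurd h (Order.not_isSuccLimit_succ _)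
    · obtain ⟨s, hs⟩ := hlim α hα hlimit f (fun β hβ => (ih β hβ (hβ.trans hα)).1)
        (fun β γ hβγ hγ => (ih γ hγ (hγ.trans hα)).2.1 β hβγ)
        (fun γ hγ hl => (ih γ hγ (hγ.trans hα)).2.2.2 hl)
      have hg : ∀ β < α, (fun β' => if β' < α then f β' else s₀) β = f β :=
        fun β hβ => if_pos hβ
      have hex : ∃ s, P α s ∧ (∀ β < α, R ((fun β' => if β' < α then f β' else s₀) β) s) ∧
          Lim α (fun β' => if β' < α then f β' else s₀) s :=
        ⟨s, hs.1, fun β hβ => by rw [hg β hβ]; exact hs.2.1 β hβ,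
          hcongr _ _ _ _ (fun β hβ => (hg β hβ).symm) hs.2.2⟩
      have hns : ∀ β, α ≠ β + 1 := by
        rintro β rfl
        rw [← Order.succ_eq_add_one] at hlimit
        exact Order.not_isSuccLimit_succ _ hlimit
      have hfe : f α = hex.choose := by
        rw [hf]
        refine (if_neg hlimit.ne_bot).trans ((dif_neg ?_).trans (dif_pos hex))
        rintro ⟨s, β, hβ, -⟩
        exact hns β hβ
      obtain ⟨h1, h2, h3⟩ := hex.choose_spec
      rw [← hfe] at h1 h2 h3
      refine ⟨h1, hle h1 fun β hβ => ?_, fun β hβ => absurd hβ (hns β), fun _ => ?_⟩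
      · have := h2 β hβ
        rwa [hg β hβ] at this
      · exact hcongr _ _ _ _ hg h3
  exact ⟨f, f0, fun α hα => (main α hα).1, fun α β hαβ hβ => (main β hβ).2.1 α hαβ,
    fun α hα => (main (α + 1) hα).2.2.1 α rfl, fun γ hγ => (main γ hγ).2.2.2⟩

namespace AEC

variable {L : FirstOrder.Language.{u, u}} {K : AEC L} {μ : Cardinal.{u}}

/-! ### Small submodels -/

theorem le_of_le_of_subset {A B C : TauModel L} (hAC : K.le A C) (hBC : K.le B C)
    (h : A.carrier ⊆ B.carrier) : K.le A B :=
  ((emb_of_le hAC).of_subset hBC fun _ hx => h hx).le fun _ _ => rfl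

theorem exists_common_extension (hμ : ℵ₀ ≤ μ) (hLST : K.LST ≤ μ) {A B N : TauModel L}
    (hA : A ∈ K.ofCard μ) (hB : B ∈ K.ofCard μ) (hAN : K.le A N) (hBN : K.le B N) :
    ∃ M ∈ K.ofCard μ, K.le A M ∧ K.le B M ∧ K.le M N := by
  have hsub : A.carrier ∪ B.carrier ⊆ N.carrier := by
    intro x hx
    rcases ZFSet.mem_union.1 hx with hx | hx
    · exact le_subset hAN hx
    · exact le_subset hBN hx
  have h1 : A.carrier ⊆ A.carrier ∪ B.carrier := fun x hx => ZFSet.mem_union.2 (Or.inl hx)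
  have h2 : B.carrier ⊆ A.carrier ∪ B.carrier := fun x hx => ZFSet.mem_union.2 (Or.inr hx)
  obtain ⟨M, hM, hMN, hZ⟩ := exists_le_of_LST hLST (K.le_mem hAN).2 hsub (le_antisymm
    ((ZFSet.card_union_le).trans (Cardinal.add_le_of_le hμ hA.2.le hB.2.le))
    (hA.2 ▸ ZFSet.card_mono h1))
  exact ⟨M, hM, le_of_le_of_subset hAN hMN fun x hx => hZ (h1 hx),
    le_of_le_of_subset hBN hMN fun x hx => hZ (h2 hx), hMN⟩

theorem exists_small_mem (hμ : ℵ₀ ≤ μ) (hLST : K.LST ≤ μ) {A N : TauModel L} {b : ZFSet.{u}}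
    (hA : A ∈ K.ofCard μ) (hAN : K.le A N) (hb : b ∈ N.carrier) :
    ∃ M ∈ K.ofCard μ, K.le A M ∧ K.le M N ∧ b ∈ M.carrier := by
  have h1 : A.carrier ⊆ insert b A.carrier := fun x hx => ZFSet.mem_insert_iff.2 (Or.inr hx)
  have hsub : insert b A.carrier ⊆ N.carrier := by
    intro x hx
    rcases ZFSet.mem_insert_iff.1 hx with rfl | hx
    · exact hb
    · exact le_subset hAN hx
  obtain ⟨M, hM, hMN, hZ⟩ := exists_le_of_LST hLST (K.le_mem hAN).2 hsub (le_antisymm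
    ((ZFSet.card_insert_le).trans
      (Cardinal.add_le_of_le hμ hA.2.le (Cardinal.one_le_aleph0.trans hμ)))
    (hA.2 ▸ ZFSet.card_mono h1))
  exact ⟨M, hM, le_of_le_of_subset hAN hMN fun x hx => hZ (h1 hx), hMN,
    hZ (ZFSet.mem_insert_iff.2 (Or.inl rfl))⟩

/-! ### Equality of Galois types over models of cardinality `μ` -/

theorem tp_eq_of_emb {A B C : TauModel L} (hAB : K.le A B) (hAC : K.le A C)
    {f : ZFSet.{u} → ZFSet.{u}} (hf : K.Emb B C f) (hfA : ∀ x ∈ A.carrier, f x = x) (b : B) (c : C)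
    (hbc : f b = c) : tp hAB b = tp hAC c := by
  refine Quot.sound ⟨C, _, _, ⟨hf.isEmbedding, (emb_of_le (K.refl (K.le_mem hAC).2)).isEmbedding,
    fun x => Subtype.ext (hfA x x.2)⟩, Subtype.ext hbc⟩

/-- Pairs over `A` that are atomically equivalent by means of models of cardinality `μ`. -/
def SmallAtomic (μ : Cardinal.{u}) {A : TauModel L} (p q : K.Pointed A) : Prop :=
  ∃ P ∈ K.ofCard μ, ∃ Q ∈ K.ofCard μ, ∃ G ∈ K.ofCard μ, K.le A P ∧ K.le A Q ∧
    K.le P p.model ∧ K.le Q q.model ∧ (p.pt : ZFSet.{u}) ∈ P.carrier ∧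
    (q.pt : ZFSet.{u}) ∈ Q.carrier ∧ K.le P G ∧
    ∃ h, K.Emb Q G h ∧ (∀ x ∈ A.carrier, h x = x) ∧ h q.pt = p.pt

namespace SmallAtomic

variable {A : TauModel L} {p q r : K.Pointed A}

theorem symm (h : SmallAtomic μ p q) : SmallAtomic μ q p := by
  obtain ⟨P, hP, Q, hQ, G, hG, hAP, hAQ, hPp, hQq, hpP, hqQ, hPG, h, hh, hhA, hpt⟩ := h
  obtain ⟨G', r, hr, hQG', hrh⟩ := hh.exists_extension
  refine ⟨Q, hQ, P, hP, G', mem_ofCard_of_isoVia hr hG, hAQ, hAP, hQq, hPp, hqQ, hpP, hQG', r,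
    (emb_of_isoVia hr hG.1).restrict hPG, fun x hx => ?_, ?_⟩
  · have := hrh x (le_subset hAQ hx)
    rwa [hhA x hx] at this
  · rw [← hpt, hrh _ hqQ]

/-- The two middle models `Q` and `Q'` may differ, but both lie in `q.model`. They have a common
extension `Q1` of cardinality `μ` there, and both amalgams are extended over `Q1` before being
amalgamated with each other. -/
theorem trans (hμ : ℵ₀ ≤ μ) (hLST : K.LST ≤ μ) (hAP : K.AmalgamationProperty μ)
    (h : SmallAtomic μ p q) (h' : SmallAtomic μ q r) : SmallAtomic μ p r := by
  obtain ⟨P, hP, Q, hQ, G, hG, hAP', hAQ, hPp, hQq, hpP, hqQ, hPG, h, hh, hhA, hpt⟩ := h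
  obtain ⟨Q', hQ', R, hR, G', hG', hAQ', hAR, hQq', hRr, hqQ', hrR, hQG', h', hh', hhA', hpt'⟩ := h'
  obtain ⟨Q1, hQ1, hQQ1, hQQ1', -⟩ := exists_common_extension hμ hLST hQ hQ' hQq hQq'
  obtain ⟨D1, hD1, hGD1, k1, hk1, hk1Q⟩ := hAP.exists_emb hQ hG hQ1 hh (emb_of_le hQQ1)
  obtain ⟨D2, hD2, hQD2, k2, hk2, hk2Q⟩ := hAP.exists_emb hQ' hQ1 hG' (emb_of_le hQQ1')
    (emb_of_le hQG')
  obtain ⟨E, hE, hDE, l, hl, hlQ⟩ := hAP.exists_emb hQ1 hD1 hD2 hk1 (emb_of_le hQD2)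
  simp only [id] at hk1Q hk2Q hlQ
  refine ⟨P, hP, R, hR, E, hE, hAP', hAR, hPp, hRr, hpP, hrR, K.trans (K.trans hPG hGD1) hDE, _,
    (hh'.comp hk2).comp hl, fun x hx => ?_, ?_⟩
  · simp only [Function.comp_apply]
    rw [hhA' x hx, hk2Q x (le_subset hAQ' hx), hlQ x (le_subset hQQ1 (le_subset hAQ hx)),
      hk1Q x (le_subset hAQ hx), hhA x hx]
  · simp only [Function.comp_apply]
    rw [hpt', hk2Q _ hqQ', hlQ _ (le_subset hQQ1 hqQ), hk1Q _ hqQ, hpt]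

theorem refl (hμ : ℵ₀ ≤ μ) (hLST : K.LST ≤ μ) (hA : A ∈ K.ofCard μ) (p : K.Pointed A) :
    SmallAtomic μ p p := by
  obtain ⟨M, hM, hAM, hMp, hpM⟩ := exists_small_mem hμ hLST hA p.le p.pt.2
  exact ⟨M, hM, M, hM, M, hM, hAM, hAM, hMp, hMp, hpM, hpM, K.refl hM.1, id,
    emb_of_le (K.refl hM.1), fun _ _ => rfl, rfl⟩

theorem of_atomic (hμ : ℵ₀ ≤ μ) (hLST : K.LST ≤ μ) (hA : A ∈ K.ofCard μ) (h : K.Atomic p q) :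
    SmallAtomic μ p q := by
  obtain ⟨G, f, g, ⟨hf, hg, hfg⟩, hpt⟩ := h
  obtain ⟨P, hP, hAP, hPp, hpP⟩ := exists_small_mem hμ hLST hA p.le p.pt.2
  obtain ⟨Q, hQ, hAQ, hQq, hqQ⟩ := exists_small_mem hμ hLST hA q.le q.pt.2
  obtain ⟨P', hP', eP⟩ := hf.emb.restrict hPp
  obtain ⟨Q', hQ', eQ⟩ := hg.emb.restrict hQq
  obtain ⟨G0, hG0, hPG, hQG, -⟩ := exists_common_extension hμ hLST (mem_ofCard_of_isoVia eP hP)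
    (mem_ofCard_of_isoVia eQ hQ) hP' hQ'
  have hPG' : K.Emb P G0 (extend f) := ⟨P', hPG, eP⟩
  have hQG' : K.Emb Q G0 (extend g) := ⟨Q', hQG, eQ⟩
  obtain ⟨G1, r, hr, hPG1, hrf⟩ := hPG'.exists_extension
  refine ⟨P, hP, Q, hQ, G1, mem_ofCard_of_isoVia hr hG0, hAP, hAQ, hPp, hQq, hpP, hqQ, hPG1, _,
    hQG'.comp (emb_of_isoVia hr hG0.1), fun x hx => ?_, ?_⟩
  · have h1 : extend f x = extend g x := by
      rw [extend_of_mem _ (le_subset p.le hx), extend_of_mem _ (le_subset q.le hx)]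
      exact congrArg Subtype.val (hfg ⟨x, hx⟩)
    rw [Function.comp_apply, ← h1, hrf x (le_subset hAP hx)]
  · rw [Function.comp_apply, extend_apply, ← hpt, ← extend_apply f, hrf _ hpP]

end SmallAtomic

/-- Amalgams witnessing equality of types may have any size, while amalgamation is only available in
cardinality `μ`. Löwenheim–Skolem cuts each atomic step down to `SmallAtomic`, which is an
equivalence relation; the resulting small amalgam is then amalgamated with `B` and `C`. -/
theorem exists_amalgam_of_tp_eq (hμ : ℵ₀ ≤ μ) (hLST : K.LST ≤ μ) (hAP : K.AmalgamationProperty μ)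
    {A B C : TauModel L} (hA : A ∈ K.ofCard μ) (hB : B ∈ K.ofCard μ) (hC : C ∈ K.ofCard μ)
    (hAB : K.le A B) (hAC : K.le A C) {b : B} {c : C} (h : tp hAB b = tp hAC c) :
    ∃ G ∈ K.ofCard μ, K.le B G ∧ ∃ f, K.Emb C G f ∧ (∀ x ∈ A.carrier, f x = x) ∧
      f c = (b : ZFSet.{u}) := by
  have key : ∀ p q : K.Pointed A, Relation.EqvGen K.Atomic p q → SmallAtomic μ p q := by
    intro p q h
    induction h with
    | rel p q h => exact .of_atomic hμ hLST hA h
    | refl p => exact .refl hμ hLST hA p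
    | symm p q _ ih => exact ih.symm
    | trans p q r _ _ ih1 ih2 => exact ih1.trans hμ hLST hAP ih2
  have h1 : SmallAtomic μ (⟨B, hAB, b⟩ : K.Pointed A) ⟨C, hAC, c⟩ := key _ _ (Quot.eqvGen_exact h)
  obtain ⟨P, hP, Q, hQ, G, hG, hAP', hAQ, hPp, hQq, hpP, hqQ, hPG, h, hh, hhA, hpt⟩ := h1
  obtain ⟨D1, hD1, hBD1, k1, hk1, hk1P⟩ := hAP.exists_emb hP hB hG (emb_of_le hPp) (emb_of_le hPG)
  obtain ⟨D, hD, hDD, k, hk, hkQ⟩ := hAP.exists_emb hQ hD1 hC (hh.comp hk1) (emb_of_le hQq)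
  simp only [id, Function.comp_apply] at hk1P hkQ
  refine ⟨D, hD, K.trans hBD1 hDD, k, hk, fun x hx => ?_, ?_⟩
  · rw [hkQ x (le_subset hAQ hx), hhA x hx, hk1P x (le_subset hAP' hx)]
  · rw [hkQ _ hqQ, hpt, hk1P _ hpP]

/-! ### Sequences of embeddings -/

variable (L) in
/-- A function between two models. -/
structure Arrow where
  /-- The domain. -/
  dom : TauModel L
  /-- The codomain. -/
  cod : TauModel L
  /-- The function. -/
  map : ZFSet.{u} → ZFSet.{u}

variable (K) in
/-- The arrow `t` extends the arrow `s`. -/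
def Extends (s t : Arrow L) : Prop :=
  K.le s.dom t.dom ∧ K.le s.cod t.cod ∧ ∀ x ∈ s.dom.carrier, t.map x = s.map x

variable (K) in
/-- The arrow is an embedding between models of cardinality `μ`. -/
def IsArrow (μ : Cardinal.{u}) (s : Arrow L) : Prop :=
  s.dom ∈ K.ofCard μ ∧ s.cod ∈ K.ofCard μ ∧ K.Emb s.dom s.cod s.map

theorem IsArrow.extends_refl {s : Arrow L} (h : K.IsArrow μ s) : K.Extends s s :=
  ⟨K.refl h.1.1, K.refl h.2.1.1, fun _ _ => rfl⟩

theorem Extends.trans {s t r : Arrow L} (h : K.Extends s t) (h' : K.Extends t r) : K.Extends s r :=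
  ⟨K.trans h.1 h'.1, K.trans h.2.1 h'.2.1, fun x hx => by
    rw [h'.2.2 x (le_subset h.1 hx), h.2.2 x hx]⟩

/-- The domain and the codomain of `s` are the unions of those of `f α`, `α < δ`. -/
def IsArrowUnion (δ : Ordinal.{u}) (f : Ordinal.{u} → Arrow L) (s : Arrow L) : Prop :=
  TauModel.IsUnion δ (fun α => (f α).dom) s.dom ∧ TauModel.IsUnion δ (fun α => (f α).cod) s.cod

theorem IsArrowUnion.congr {δ : Ordinal.{u}} {f g : Ordinal.{u} → Arrow L} {s : Arrow L}
    (hfg : ∀ α < δ, f α = g α) (h : IsArrowUnion δ f s) : IsArrowUnion δ g s :=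
  ⟨h.1.congr fun α hα => by rw [hfg α hα], h.2.congr fun α hα => by rw [hfg α hα]⟩

theorem isChain_of_arrows {δ : Ordinal.{u}} {f : Ordinal.{u} → Arrow L}
    (hmono : ∀ α β, α ≤ β → β < δ → K.Extends (f α) (f β))
    (hcont : ∀ γ < δ, Order.IsSuccLimit γ → IsArrowUnion γ f (f γ)) :
    K.IsChain δ (fun α => (f α).dom) ∧ K.IsChain δ (fun α => (f α).cod) :=
  ⟨⟨fun α β h1 h2 => (hmono α β h1 h2).1, fun γ h1 h2 => (hcont γ h1 h2).1⟩,
    ⟨fun α β h1 h2 => (hmono α β h1 h2).2.1, fun γ h1 h2 => (hcont γ h1 h2).2⟩⟩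

/-- The union `U` of the domains is prescribed because several sequences of arrows must end with the
same domain. The separate bound `ν` admits unions of `μ`-many arrows of smaller cardinality. -/
theorem exists_arrowUnion (hμ : ℵ₀ ≤ μ) {δ : Ordinal.{u}} (hδ : Order.IsSuccLimit δ)
    (hδμ : δ.card ≤ μ) {f : Ordinal.{u} → Arrow L} {ν : Cardinal.{u}} (hν : ν ≤ μ)
    (hf : ∀ α < δ, K.IsArrow ν (f α))
    (hmono : ∀ α β, α ≤ β → β < δ → K.Extends (f α) (f β))
    (hcont : ∀ γ < δ, Order.IsSuccLimit γ → IsArrowUnion γ f (f γ))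
    {U : TauModel L} (hU : TauModel.IsUnion δ (fun α => (f α).dom) U) (hUμ : U ∈ K.ofCard μ) :
    ∃ V g, K.IsArrow μ ⟨U, V, g⟩ ∧ (∀ α < δ, K.Extends (f α) ⟨U, V, g⟩) ∧
      IsArrowUnion δ f ⟨U, V, g⟩ := by
  obtain ⟨hC, hD⟩ := isChain_of_arrows hmono hcont
  obtain ⟨V, hV⟩ := hD.exists_isUnion hδ.bot_lt
  obtain ⟨g, hg⟩ := exists_glue (C := fun α => (f α).dom) (g := fun α => (f α).map)
    fun α β h1 h2 => (hmono α β h1 h2).2.2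
  have hE : K.Emb U V g := hC.union_emb_union hD hδ hU hV (fun α hα => (hf α hα).2.2) hg
  refine ⟨V, g, ⟨hUμ, ⟨hE.mem_right, le_antisymm ?_ ?_⟩, hE⟩,
    fun α hα => ⟨hC.le_union hU hα, hD.le_union hV hα, hg α hα⟩, hU, hV⟩
  · exact hV.card_le hμ hδμ fun α hα => (hf α hα).2.1.2.le.trans hν
  · rw [← hUμ.2]
    exact hE.card_le

end AEC

/-! ### Stability and universal extensions. -/

namespace AEC

variable {L : FirstOrder.Language.{u, u}} {K : AEC L} {μ : Cardinal.{u}}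

theorem card_le_of_lt_ord_add_one {δ : Ordinal.{u}} (h : δ < μ.ord + 1) : δ.card ≤ μ := by
  have := Ordinal.card_le_card (Order.lt_add_one_iff.1 h)
  rwa [Cardinal.card_ord] at this

/-- Every type over `N` given by a model of cardinality `μ` is realized in `N'`. -/
def Realizes (K : AEC L) (μ : Cardinal.{u}) (N N' : TauModel L) : Prop :=
  ∀ E ∈ K.ofCard μ, ∀ g, K.Emb N E g → ∀ e ∈ E.carrier, ∃ c ∈ N'.carrier, ∃ G ∈ K.ofCard μ,
    K.le E G ∧ ∃ h, K.Emb N' G h ∧ (∀ x ∈ N.carrier, h x = g x) ∧ h c = e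

theorem exists_model_realizing_Sna (hμ : ℵ₀ ≤ μ) (hLST : K.LST ≤ μ)
    (hAP : K.AmalgamationProperty μ) (hst : K.Stable μ) {N : TauModel L} (hN : N ∈ K.ofCard μ) :
    ∃ N' ∈ K.ofCard μ, ∃ h : K.le N N', ∀ t ∈ K.Sna N, ∃ c : N', tp h c = t := by
  obtain ⟨ι⟩ : Nonempty (K.Sna N ↪ μ.ord.ToType) := by
    rw [← Cardinal.lift_mk_le']
    rw [Cardinal.mk_ord_toType, Cardinal.lift_id'.{u, u + 1}]
    exact hst N hN
  let i : K.Sna N → Ordinal.{u} := fun t => (Ordinal.ToType.mk.symm (ι t)).1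
  have hi : ∀ t, i t < μ.ord := fun t => (Ordinal.ToType.mk.symm (ι t)).2
  have hinj : Function.Injective i := fun s t h =>
    ι.injective (Ordinal.ToType.mk.symm.injective (Subtype.ext h))
  -- Length `μ.ord + 1` makes the union of the first `μ.ord` stages a member of the sequence. The
  -- type with index `i t` is realized at stage `i t + 1`.
  obtain ⟨f, -, hfP, hfR, hfQ, -⟩ := exists_transfinite_sequence (μ.ord + 1)
    (fun _ s => s ∈ K.ofCard μ ∧ K.le N s) K.le
    (fun α _ s' => ∀ t, i t = α → ∃ (h : K.le N s') (c : s'), tp h c = t.1)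
    (fun δ f s => TauModel.IsUnion δ f s) (fun _ s h => K.refl h.1.1)
    (fun _ _ _ h h' => K.trans h h') (fun δ f g s h h' => h'.congr h) N ⟨hN, K.refl hN.1⟩
    (by
      rintro α - s ⟨hs, hNs⟩
      by_cases ht : ∃ t, i t = α
      · obtain ⟨t, rfl⟩ := ht
        obtain ⟨B, hNB, b, -, htb⟩ := t.2
        obtain ⟨B', hB', hNB', hBB', hb⟩ := exists_small_mem hμ hLST hN hNB b.2
        obtain ⟨D, hD, hsD, h, hh, hhN⟩ := hAP.exists_emb hN hs hB' (emb_of_le hNs)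
          (emb_of_le hNB')
        refine ⟨D, ⟨hD, K.trans hNs hsD⟩, hsD, fun t' ht' => ?_⟩
        obtain rfl := hinj ht'
        refine ⟨K.trans hNs hsD, ⟨h b, hh.map_mem hb⟩, ?_⟩
        rw [htb, ← tp_eq_of_emb hNB' hNB (emb_of_le hBB') (fun _ _ => rfl) ⟨b, hb⟩ b rfl]
        exact (tp_eq_of_emb _ _ hh (fun x hx => hhN x hx) ⟨b, hb⟩ _ rfl).symm
      · exact ⟨s, ⟨hs, hNs⟩, K.refl hs.1, fun t h => absurd ⟨t, h⟩ ht⟩)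
    (by
      intro δ hδ hlim f hP hR hL
      have hC : K.IsChain δ f := ⟨hR, hL⟩
      obtain ⟨U, hU⟩ := hC.exists_isUnion hlim.bot_lt
      refine ⟨U, ⟨hC.card_union hlim.bot_lt hU hμ (card_le_of_lt_ord_add_one hδ)
        fun α hα => (hP α hα).1, ?_⟩, fun α hα => hC.le_union hU hα, hU⟩
      exact K.trans (hP 0 hlim.bot_lt).2 (hC.le_union hU hlim.bot_lt))
  have htop : μ.ord < μ.ord + 1 := Order.lt_add_one_iff.2 le_rfl
  refine ⟨f μ.ord, (hfP _ htop).1, (hfP _ htop).2, fun t ht => ?_⟩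
  have hlt : i ⟨t, ht⟩ + 1 ≤ μ.ord := Order.add_one_le_iff.2 (hi _)
  obtain ⟨h, c, hc⟩ := hfQ (i ⟨t, ht⟩) (hlt.trans_lt htop) ⟨t, ht⟩ rfl
  have hle := hfR _ _ hlt htop
  refine ⟨⟨c, le_subset hle c.2⟩, ?_⟩
  exact Eq.trans (tp_eq_of_emb _ _ (emb_of_le hle) (fun _ _ => rfl) c _ rfl).symm hc

theorem exists_realizes (hμ : ℵ₀ ≤ μ) (hLST : K.LST ≤ μ)
    (hAP : K.AmalgamationProperty μ) (hst : K.Stable μ) {N : TauModel L} (hN : N ∈ K.ofCard μ) :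
    ∃ N' ∈ K.ofCard μ, K.le N N' ∧ Realizes K μ N N' := by
  obtain ⟨N', hN', hNN', hreal⟩ := exists_model_realizing_Sna hμ hLST hAP hst hN
  refine ⟨N', hN', hNN', fun E hE g hg e he => ?_⟩
  obtain ⟨E', r, hr, hNE', hrg⟩ := hg.exists_extension
  have hE' := mem_ofCard_of_isoVia hr hE
  have hrE := emb_of_isoVia hr hE.1
  -- `Sna` covers only non-algebraic types; an element that is renamed into `N` is realized by
  -- itself.
  by_cases hre : r e ∈ N.carrier
  · obtain ⟨G, hG, hEG, h, hh, hhN⟩ := hAP.exists_emb hN hE hN' hg (emb_of_le hNN')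
    refine ⟨r e, le_subset hNN' hre, G, hG, hEG, h, hh, hhN, ?_⟩
    have h1 : h (r e) = g (r e) := hhN _ hre
    rw [h1]
    exact hrE.inj (hg.map_mem hre) he (hrg _ hre)
  · obtain ⟨c, hc⟩ := hreal (tp hNE' ⟨r e, hr.mem he⟩) ⟨E', hNE', ⟨r e, hr.mem he⟩, hre, rfl⟩
    obtain ⟨G, hG, hEG, h, hh, hhN, hhc⟩ :=
      exists_amalgam_of_tp_eq hμ hLST hAP hN hE' hN' hNE' hNN' hc.symm
    obtain ⟨G', r', hr', hEG', hrr⟩ := (hrE.trans_le hEG).exists_extension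
    refine ⟨c, c.2, G', mem_ofCard_of_isoVia hr' hG, hEG', _, hh.comp (emb_of_isoVia hr' hG.1),
      fun x hx => ?_, ?_⟩
    · rw [Function.comp_apply, hhN x hx, ← hrg x hx, hrr _ (hg.map_mem hx), hrg x hx]
    · rw [Function.comp_apply, hhc, hrr e he]

/-- Stability and amalgamation yield universal models over a given model. -/
theorem exists_universal (hμ : ℵ₀ ≤ μ) (hLST : K.LST ≤ μ)
    (hAP : K.AmalgamationProperty μ) (hst : K.Stable μ) {M : TauModel L} (hM : M ∈ K.ofCard μ) :
    ∃ N ∈ K.ofCard μ, K.le M N ∧ ∀ E ∈ K.ofCard μ, ∀ g, K.Emb M E g →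
      ∃ h, K.Emb E N h ∧ ∀ x ∈ M.carrier, h (g x) = x := by
  have htop : μ.ord < μ.ord + 1 := Order.lt_add_one_iff.2 le_rfl
  have hμlim : Order.IsSuccLimit μ.ord := Cardinal.isSuccLimit_ord hμ
  obtain ⟨N, hN0, hNP, hNR, hNQ, hNL⟩ := exists_transfinite_sequence (μ.ord + 1)
    (fun _ s => s ∈ K.ofCard μ) K.le (fun _ s s' => Realizes K μ s s')
    (fun δ f s => TauModel.IsUnion δ f s) (fun _ s h => K.refl h.1)
    (fun _ _ _ h h' => K.trans h h') (fun δ f g s h h' => h'.congr h) M hM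
    (by
      intro α _ s hs
      exact exists_realizes hμ hLST hAP hst hs)
    (by
      intro δ hδ hlim f hP hR hL
      have hC : K.IsChain δ f := ⟨hR, hL⟩
      obtain ⟨U, hU⟩ := hC.exists_isUnion hlim.bot_lt
      exact ⟨U, hC.card_union hlim.bot_lt hU hμ (card_le_of_lt_ord_add_one hδ) hP,
        fun α hα => hC.le_union hU hα, hU⟩)
  refine ⟨N μ.ord, hNP _ htop, hN0 ▸ hNR 0 _ hμlim.bot_lt.le htop, fun E hE g hg => ?_⟩
  obtain ⟨en⟩ : Nonempty (E.carrier ↪ μ.ord.ToType) := by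
    rw [← Cardinal.lift_mk_le', ZFSet.cardinalMk_coe_sort]
    have : E.carrier.card = μ := hE.2
    simp [this]
  let i : E.carrier → Ordinal.{u} := fun t => (Ordinal.ToType.mk.symm (en t)).1
  have hi : ∀ t, i t < μ.ord := fun t => (Ordinal.ToType.mk.symm (en t)).2
  have hinj : Function.Injective i := fun s t h =>
    en.injective (Ordinal.ToType.mk.symm.injective (Subtype.ext h))
  -- Maps from `N α` into growing extensions of `E` are built so that each element of `E` eventually
  -- enters the range. The last map has all of `E` in its range, and its inverse embeds `E` into `N
  -- μ.ord`.
  obtain ⟨f, hf0, hfP, hfR, hfQ, hfL⟩ := exists_transfinite_sequence (μ.ord + 1)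
    (fun α s => s.dom = N α ∧ K.IsArrow μ s ∧ K.le E s.cod) K.Extends
    (fun α s s' => ∀ t, i t = α → ∃ c ∈ s'.dom.carrier, s'.map c = t)
    IsArrowUnion (fun _ s h => h.2.1.extends_refl) (fun _ _ _ h h' => h.trans h')
    (fun δ f g s h h' => h'.congr h) ⟨M, E, g⟩ ⟨hN0.symm, ⟨hM, hE, hg⟩, K.refl hE.1⟩
    (by
      rintro α hα s ⟨hsN, hs, hEs⟩
      have hα' : α < α + 1 := Order.lt_add_one_iff.2 le_rfl
      have hle : K.le s.dom (N (α + 1)) := hsN ▸ hNR _ _ hα'.le hα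
      by_cases ht : ∃ t, i t = α
      · obtain ⟨t, rfl⟩ := ht
        obtain ⟨c, hc, G, hG, hsG, h, hh, hhN, hhc⟩ := hNQ _ hα s.cod hs.2.1 s.map
          (hsN ▸ hs.2.2) t (le_subset hEs t.2)
        refine ⟨⟨N (i t + 1), G, h⟩, ⟨rfl, ⟨hNP _ hα, hG, hh⟩, K.trans hEs hsG⟩,
          ⟨hle, hsG, fun x hx => hhN x (hsN ▸ hx)⟩, fun t' ht' => ?_⟩
        obtain rfl := hinj ht'
        exact ⟨c, hc, hhc⟩
      · obtain ⟨G, hG, hsG, h, hh, hhN⟩ := hAP.exists_emb hs.1 hs.2.1 (hNP _ hα) hs.2.2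
          (emb_of_le hle)
        exact ⟨⟨N (α + 1), G, h⟩, ⟨rfl, ⟨hNP _ hα, hG, hh⟩, K.trans hEs hsG⟩,
          ⟨hle, hsG, hhN⟩, fun t h => absurd ⟨t, h⟩ ht⟩)
    (by
      intro δ hδ hlim f hP hR hL
      have hU : TauModel.IsUnion δ (fun α => (f α).dom) (N δ) :=
        (hNL δ hδ hlim).congr fun α hα => (hP α hα).1.symm
      obtain ⟨V, g, h1, h2, h3⟩ := exists_arrowUnion hμ hlim (card_le_of_lt_ord_add_one hδ) le_rfl
        (fun α hα => (hP α hα).2.1) hR hL hU (hNP δ hδ)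
      exact ⟨_, ⟨rfl, h1, K.trans (hP 0 hlim.bot_lt).2.2 (h2 0 hlim.bot_lt).2.1⟩, h2, h3⟩)
  obtain ⟨htdom, htA, htE⟩ := hfP _ htop
  obtain ⟨A', hA', hiso⟩ := htA.2.2
  obtain ⟨s, hs, hs1, -⟩ := hiso.exists_inv
  have hEA' : K.le E A' := by
    refine le_of_le_of_subset htE hA' fun x hx => ?_
    have hlt : i ⟨x, hx⟩ + 1 ≤ μ.ord := Order.add_one_le_iff.2 (hi _)
    obtain ⟨c, hc, hcx⟩ := hfQ _ (hlt.trans_lt htop) ⟨x, hx⟩ rfl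
    have hext := hfR _ _ hlt htop
    have := hiso.mem (le_subset hext.1 hc)
    rwa [hext.2.2 c hc, hcx] at this
  refine ⟨s, htdom ▸ (emb_of_isoVia hs (K.le_mem hA').1).restrict hEA', fun x hx => ?_⟩
  have hext := hfR 0 _ hμlim.bot_lt.le htop
  rw [hf0] at hext
  have h1 : (f μ.ord).map x = g x := hext.2.2 x hx
  rw [← h1, hs1 x (le_subset hext.1 hx)]

end AEC

/-! ### Triples as arrows: incompatible extensions and homogeneity. -/

namespace AEC

variable {L : FirstOrder.Language.{u, u}} {K : AEC L} {μ : Cardinal.{u}} {b : ZFSet.{u}}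

/-- Lying in `A` is invariant under atomic equivalence, since embeddings are injective and the two
maps agree on `A`; hence it is a property of the type. -/
theorem not_mem_of_tp_mem_Sna {A B : TauModel L} (h : K.le A B) (b : B) (hb : tp h b ∈ K.Sna A) :
    (b : ZFSet.{u}) ∉ A.carrier := by
  let alg : K.GaloisType A → Prop := Quot.lift (fun p => (p.pt : ZFSet.{u}) ∈ A.carrier) (by
    rintro p q ⟨G, f, g, ⟨hf, hg, hfg⟩, hpt⟩
    apply propext
    constructor
    · intro hp
      have h1 := hfg ⟨_, hp⟩
      have h2 : incl p.le ⟨_, hp⟩ = p.pt := rfl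
      rw [h2, hpt] at h1
      have h3 : extend g q.pt = extend g p.pt := by
        rw [extend_of_mem _ (le_subset q.le hp), extend_apply]
        exact congrArg Subtype.val h1
      rw [hg.emb.inj q.pt.2 (le_subset q.le hp) h3]
      exact hp
    · intro hq
      have h1 := hfg ⟨_, hq⟩
      have h2 : incl q.le ⟨_, hq⟩ = q.pt := rfl
      rw [h2, ← hpt] at h1
      have h3 : extend f p.pt = extend f q.pt := by
        rw [extend_of_mem _ (le_subset p.le hq), extend_apply]
        exact congrArg Subtype.val h1.symm
      rw [hf.emb.inj p.pt.2 (le_subset p.le hq) h3]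
      exact hq)
  obtain ⟨B', h', b', hb', he⟩ := hb
  have h1 : alg (tp h b) = alg (tp h' b') := congrArg alg he
  intro hmem
  have h2 : alg (tp h b) := hmem
  rw [h1] at h2
  exact hb' h2

/-- An embedding between models of cardinality `μ` such that `b` is an element of the codomain
outside of the range. -/
def IsTriple (K : AEC L) (μ : Cardinal.{u}) (b : ZFSet.{u}) (s : Arrow L) : Prop :=
  K.IsArrow μ s ∧ b ∈ s.cod.carrier ∧ ∀ x ∈ s.dom.carrier, s.map x ≠ b

/-- The renaming of one of the amalgamations given by a failure of domination. -/
theorem exists_triple_of_isAmalgamation {s : Arrow L} (hs : K.IsTriple μ b s)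
    {C C₁ C₂ D : TauModel L} (hC : s.dom.IsoVia C s.map) (hCs : K.le C s.cod) (hCC₁ : K.le C C₁)
    {k k' : ZFSet.{u} → ZFSet.{u}} (hk' : C₂.IsoVia C₁ k') (hC₂ : C₂ ∈ K.ofCard μ)
    (hsC₂ : K.le s.dom C₂) (hks : ∀ x ∈ s.dom.carrier, k (s.map x) = x)
    (hkk : ∀ x ∈ C₁.carrier, k' (k x) = x) (hD : D ∈ K.ofCard μ) (hCD : K.le C₁ D)
    {f : s.cod → D} (hf : K.IsAmalgamation hCs hCC₁ f (incl hCD))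
    (hb : (f ⟨b, hs.2.1⟩ : ZFSet.{u}) ∉ C₁.carrier) :
    ∃ D' r, D.IsoVia D' r ∧ (∀ x ∈ s.cod.carrier, r (extend f x) = x) ∧
      K.IsTriple μ b ⟨C₂, D', r ∘ k'⟩ ∧ K.Extends s ⟨C₂, D', r ∘ k'⟩ := by
  have hk'C := emb_of_isoVia hk' hC₂.1
  obtain ⟨D', r, hr, hsD', hrf⟩ := hf.1.emb.exists_extension
  have hrD := emb_of_isoVia hr hD.1
  refine ⟨D', r, hr, hrf, ⟨⟨hC₂, mem_ofCard_of_isoVia hr hD,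
    (hk'C.trans_le hCD).comp hrD⟩, le_subset hsD' hs.2.1, fun x hx hxb => hb ?_⟩,
    hsC₂, hsD', fun x hx => ?_⟩
  · have h1 : r (k' x) = b := hxb
    have h2 := hrf b hs.2.1
    have h3 : k' x = extend f b := hrD.inj (le_subset hCD (hk'C.map_mem hx))
      (hf.1.emb.map_mem hs.2.1) (h1.trans h2.symm)
    rw [extend_of_mem _ hs.2.1] at h3
    rw [← h3]
    exact hk'C.map_mem hx
  · have hxC := hC.mem hx
    have h1 : k' x = s.map x := by
      conv_lhs => rw [← hks x hx]
      exact hkk _ (le_subset hCC₁ hxC)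
    have h2 : extend f (s.map x) = s.map x := by
      rw [extend_of_mem _ (le_subset hCs hxC)]
      exact congrArg Subtype.val (hf.2.2 ⟨_, hxC⟩)
    change r (k' x) = s.map x
    rw [h1]
    conv_lhs => rw [← h2]
    exact hrf _ (le_subset hCs hxC)

/-- Two embeddings with a common domain, extending `s`, that cannot be reconciled over `s`. -/
def Incompatible (K : AEC L) (s s₀ s₁ : Arrow L) : Prop :=
  s₀.dom = s₁.dom ∧ K.Extends s s₀ ∧ K.Extends s s₁ ∧ ¬ ∃ N h₀ h₁, K.Emb s₀.cod N h₀ ∧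
    K.Emb s₁.cod N h₁ ∧ (∀ x ∈ s.cod.carrier, h₀ x = h₁ x) ∧
      ∀ x ∈ s₀.dom.carrier, h₀ (s₀.map x) = h₁ (s₁.map x)

/-- Over an unchanged domain any amalgam of the two codomains over `s.cod` would reconcile the
arrows. The new elements make the union of the tree have cardinality `μ⁺`. -/
theorem Incompatible.exists_new (hAP : K.AmalgamationProperty μ) {s s₀ s₁ : Arrow L}
    (h : K.Incompatible s s₀ s₁) (hs : K.IsArrow μ s) (hs₀ : K.IsArrow μ s₀)
    (hs₁ : K.IsArrow μ s₁) : ∃ x ∈ s₀.dom.carrier, x ∉ s.dom.carrier := by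
  obtain ⟨hdom, h0, h1, hN⟩ := h
  by_contra! hsub
  obtain ⟨N, hN', h0N, h, hh, hhs⟩ := hAP.exists_emb hs.2.1 hs₀.2.1 hs₁.2.1 (emb_of_le h0.2.1)
    (emb_of_le h1.2.1)
  refine hN ⟨N, id, h, emb_of_le h0N, hh, fun x hx => (hhs x hx).symm, fun x hx => ?_⟩
  have hx' := hsub x hx
  rw [h0.2.2 x hx', h1.2.2 x hx']
  exact (hhs _ (hs.2.2.map_mem hx')).symm

/-- Domination fails for the range `C` of `s` inside `s.cod`. The witness over `C` is pulled back
along `s.map` to a common new domain, and the two amalgams are renamed to extend `s.cod`. A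
reconciliation of the resulting arrows would make the amalgamations equivalent. -/
theorem exists_incompatible {A B : TauModel L}
    (hnd : ∀ C D, K.le A C → K.le B D → ¬ K.IsDominationTriple μ C D b) (hAB : K.le A B)
    {s : Arrow L} (hs : K.IsTriple μ b s) (hext : K.Extends ⟨A, B, id⟩ s) :
    ∃ s₀ s₁, K.IsTriple μ b s₀ ∧ K.IsTriple μ b s₁ ∧ K.Incompatible s s₀ s₁ := by
  obtain ⟨C, hCs, hC⟩ := hs.1.2.2
  have hCμ := mem_ofCard_of_isoVia hC hs.1.1
  have hbC : b ∉ C.carrier := by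
    intro hb
    obtain ⟨x, hx, hxb⟩ := hC.surj hb
    exact hs.2.2 x hx hxb
  have hAC : K.le A C := le_of_le_of_subset (K.trans hAB hext.2.1) hCs fun x hx => by
    have h1 := hC.mem (le_subset hext.1 hx)
    rwa [hext.2.2 x hx] at h1
  have hnd' := hnd C s.cod hAC hext.2.1
  have hna : K.IsNonalgebraicTriple μ C s.cod b :=
    ⟨hCμ, hs.1.2.1, ⟨hCs, fun h => hbC (h ▸ hs.2.1)⟩, hs.2.1, hbC⟩
  rw [IsDominationTriple] at hnd'
  push Not at hnd'
  obtain ⟨_, _, C₁, hC₁, hCC₁, D, hD, F, hF, hCD, hCF, fD, fF, haD, haF, hne, htp, hsna⟩ := hnd' hna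
  have hbD := not_mem_of_tp_mem_Sna hCD _ hsna
  have hbF := not_mem_of_tp_mem_Sna hCF _ (htp ▸ hsna)
  have hgC₁ : K.Emb s.dom C₁ s.map := ⟨C, hCC₁, hC⟩
  obtain ⟨C₂, k, hk, hsC₂, hks⟩ := hgC₁.exists_extension
  obtain ⟨k', hk', hkk, hkk'⟩ := hk.exists_inv
  have hC₂ := mem_ofCard_of_isoVia hk hC₁
  obtain ⟨D', r₀, hr₀, hrf₀, ht₀, he₀⟩ := exists_triple_of_isAmalgamation hs hC hCs hCC₁ hk' hC₂
    hsC₂ hks hkk hD hCD haD hbD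
  obtain ⟨F', r₁, hr₁, hrf₁, ht₁, he₁⟩ := exists_triple_of_isAmalgamation hs hC hCs hCC₁ hk' hC₂
    hsC₂ hks hkk hF hCF haF hbF
  refine ⟨_, _, ht₀, ht₁, rfl, he₀, he₁, ?_⟩
  rintro ⟨N, h₀, h₁, hh₀, hh₁, hcod, hdom⟩
  refine hne ⟨N, _, _, ((emb_of_isoVia hr₀ hD.1).comp hh₀).isEmbedding,
    ((emb_of_isoVia hr₁ hF.1).comp hh₁).isEmbedding, fun x => Subtype.ext ?_,
    fun x => Subtype.ext ?_⟩
  · have e0 := hrf₀ x x.2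
    have e1 := hrf₁ x x.2
    rw [extend_apply] at e0 e1
    simp only [Function.comp_apply]
    rw [e0, e1, hcod x x.2]
  · have e := hdom (k x) (hk.mem x.2)
    simp only [Function.comp_apply, hkk x x.2] at e
    exact e

/-- Any two triples extending `T` with the same domain can be extended to triples over the same
larger models. -/
def Homogeneous (K : AEC L) (μ : Cardinal.{u}) (b : ZFSet.{u}) (T : Arrow L) : Prop :=
  ∀ s t u, K.IsTriple μ b s → K.IsTriple μ b t → K.IsTriple μ b u → K.Extends T s →
    K.Extends T t → s.dom = t.dom → K.Extends s u →
    ∃ v, K.IsTriple μ b v ∧ K.Extends t v ∧ v.dom = u.dom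

theorem card_le_of_lt_ord_succ {δ : Ordinal.{u}} (h : δ < (Order.succ μ).ord) : δ.card ≤ μ :=
  Order.lt_succ_iff.1 (Cardinal.lt_ord.1 h)

theorem le_card_of_ne {κ : Cardinal.{u}} {Z : ZFSet.{u}} {x : Ordinal.{u} → ZFSet.{u}}
    (hx : ∀ α < κ.ord, x α ∈ Z) (hne : ∀ α β, α < β → β < κ.ord → x α ≠ x β) : κ ≤ Z.card := by
  let e := Ordinal.ToType.mk (o := κ.ord)
  have he : ∀ i, (e.symm i : Ordinal.{u}) < κ.ord := fun i => (e.symm i).2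
  let F : κ.ord.ToType → Z := fun i => ⟨x (e.symm i), hx _ (he i)⟩
  have hF : Function.Injective F := by
    intro i j hij
    have hij' := congrArg Subtype.val hij
    rcases lt_trichotomy (e.symm i : Ordinal.{u}) (e.symm j) with h | h | h
    · exact absurd hij' (hne _ _ h (he j))
    · exact e.symm.injective (Subtype.ext h)
    · exact absurd hij'.symm (hne _ _ h (he i))
  have hcard := Cardinal.mk_le_of_injective (f := fun i : ULift.{u + 1} _ => F i.down)
    (hF.comp ULift.down_injective)
  rwa [Cardinal.mk_uLift, Cardinal.mk_ord_toType, ZFSet.cardinalMk_coe_sort,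
    Cardinal.lift_le] at hcard

theorem isTriple_of_isUnion {δ : Ordinal.{u}} (hδ : 0 < δ) {f : Ordinal.{u} → Arrow L}
    (hf : ∀ α < δ, K.IsTriple μ b (f α)) {s : Arrow L} (hs : K.IsArrow μ s)
    (hext : ∀ α < δ, K.Extends (f α) s) (hU : IsArrowUnion δ f s) : K.IsTriple μ b s := by
  refine ⟨hs, le_subset (hext 0 hδ).2.1 (hf 0 hδ).2.1, fun x hx => ?_⟩
  obtain ⟨α, hα, hxα⟩ := (hU.1.1 x).1 hx
  rw [(hext α hα).2.2 x hxα]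
  exact (hf α hα).2.2 x hxα

/-- If `T` is not homogeneous, then `b` can be realized, as an element over `T`, by a new element
of the domain of some larger triple. -/
theorem exists_realization_of_not_homogeneous (hAP : K.AmalgamationProperty μ) {T : Arrow L}
    (hT : ¬ K.Homogeneous μ b T) : ∃ u, K.IsTriple μ b u ∧ K.Extends T u ∧
      ∃ c ∈ u.dom.carrier, c ∉ T.dom.carrier ∧ ∃ E ∈ K.ofCard μ, K.le T.cod E ∧ ∃ k,
        K.Emb u.dom E k ∧ (∀ x ∈ T.dom.carrier, k x = T.map x) ∧ k c = b := by
  rw [Homogeneous] at hT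
  push Not at hT
  obtain ⟨s, t, u, hs, ht, hu, hTs, hTt, hst, hsu, hno⟩ := hT
  -- If `b` were outside the image of `u.dom`, this amalgam would be the extension of `t` that is
  -- assumed not to exist; so `b` is the image of some `c`.
  obtain ⟨E, hE, htE, k, hk, hkt⟩ := hAP.exists_emb ht.1.1 ht.1.2.1 hu.1.1 ht.1.2.2
    (emb_of_le (hst ▸ hsu.1))
  have hext : K.Extends t ⟨u.dom, E, k⟩ := ⟨hst ▸ hsu.1, htE, hkt⟩
  obtain ⟨c, hc, hcb⟩ : ∃ c ∈ u.dom.carrier, k c = b := by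
    by_contra! hcon
    exact hno ⟨u.dom, E, k⟩ ⟨⟨hu.1.1, hE, hk⟩, le_subset htE ht.2.1, hcon⟩ hext rfl
  refine ⟨u, hu, hTs.trans hsu, c, hc, fun hcT => ?_, E, hE, K.trans hTt.2.1 htE, k, hk,
    (hTt.trans hext).2.2, hcb⟩
  have hct := le_subset hTt.1 hcT
  exact ht.2.2 c hct ((hkt c hct).symm.trans hcb)

/-- If triples over `T₀` extend to every larger domain, `T₀` is itself homogeneous. Otherwise fix
`T` and `C` for which this fails; a chain of non-homogeneous triples over `T` of length `μ⁺` would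
create more realizations of `b` than `C` can contain. -/
theorem exists_homogeneous (hμ : ℵ₀ ≤ μ) (hAP : K.AmalgamationProperty μ) {T₀ : Arrow L}
    (hT₀ : K.IsTriple μ b T₀) :
    ∃ T, K.IsTriple μ b T ∧ K.Extends T₀ T ∧ K.Homogeneous μ b T := by
  by_cases hall : ∀ T, K.IsTriple μ b T → K.Extends T₀ T → ∀ C ∈ K.ofCard μ, K.le T.dom C →
      ∃ v, K.IsTriple μ b v ∧ K.Extends T v ∧ v.dom = C
  · exact ⟨T₀, hT₀, hT₀.1.extends_refl, fun s t u _ ht hu _ hTt hst hsu =>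
      hall t ht hTt _ hu.1.1 (hst ▸ hsu.1)⟩
  push Not at hall
  obtain ⟨T, hT, hT₀T, C, hC, hTC, hno⟩ := hall
  by_contra! hcon
  have hnh : ∀ s, K.IsTriple μ b s → K.Extends T s → ¬ K.Homogeneous μ b s :=
    fun s hs hTs => hcon s hs (hT₀T.trans hTs)
  -- The first component is the chain of triples; the second maps its domains into extensions of
  -- `C`, starting from the inclusion of `T.dom`.
  obtain ⟨f, hf0, hfP, hfR, hfQ, -⟩ := exists_transfinite_sequence (S := Arrow L × Arrow L)
    (Order.succ μ).ord
    (fun _ s => K.IsTriple μ b s.1 ∧ K.IsArrow μ s.2 ∧ s.2.dom = s.1.dom ∧ K.Extends T s.1 ∧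
      K.Extends ⟨T.dom, C, id⟩ s.2)
    (fun s t => K.Extends s.1 t.1 ∧ K.Extends s.2 t.2)
    (fun _ s u => ∃ c ∈ u.1.dom.carrier, c ∉ s.1.dom.carrier ∧
      ∃ E ∈ K.ofCard μ, K.le s.1.cod E ∧ ∃ k, K.Emb u.1.dom E k ∧
        (∀ x ∈ s.1.dom.carrier, k x = s.1.map x) ∧ k c = b)
    (fun δ f s => IsArrowUnion δ (fun α => (f α).1) s.1 ∧ IsArrowUnion δ (fun α => (f α).2) s.2)
    (fun _ s h => ⟨h.1.1.extends_refl, h.2.1.extends_refl⟩)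
    (fun _ _ _ h h' => ⟨h.1.trans h'.1, h.2.trans h'.2⟩)
    (fun δ f g s h h' => ⟨h'.1.congr fun α hα => by rw [h α hα],
      h'.2.congr fun α hα => by rw [h α hα]⟩)
    (T, ⟨T.dom, C, id⟩)
    (by
      have : K.IsArrow μ ⟨T.dom, C, id⟩ := ⟨hT.1.1, hC, emb_of_le hTC⟩
      exact ⟨hT, this, rfl, hT.1.extends_refl, this.extends_refl⟩)
    (by
      rintro α hα ⟨s, r⟩ ⟨hs, hr, hrs, hTs, hCr⟩
      obtain ⟨u, hu, hsu, hc⟩ := exists_realization_of_not_homogeneous hAP (hnh s hs hTs)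
      dsimp only at hrs
      have hru : K.le r.dom u.dom := hrs ▸ hsu.1
      obtain ⟨G, hG, hrG, h, hh, hhr⟩ := hAP.exists_emb hr.1 hr.2.1 hu.1.1 hr.2.2 (emb_of_le hru)
      have hext : K.Extends r ⟨u.dom, G, h⟩ := ⟨hru, hrG, hhr⟩
      exact ⟨(u, ⟨u.dom, G, h⟩), ⟨hu, ⟨hu.1.1, hG, hh⟩, rfl, hTs.trans hsu, hCr.trans hext⟩,
        ⟨hsu, hext⟩, hc⟩)
    (by
      intro δ hδ hlim f hP hR hL
      have hδμ := card_le_of_lt_ord_succ hδ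
      have hch := (isChain_of_arrows (fun α β h1 h2 => (hR α β h1 h2).1)
        fun γ h1 h2 => (hL γ h1 h2).1).1
      obtain ⟨U, hU⟩ := hch.exists_isUnion hlim.bot_lt
      have hUμ := hch.card_union hlim.bot_lt hU hμ hδμ fun α hα => (hP α hα).1.1.1
      obtain ⟨V, g, h1, h2, h3⟩ := exists_arrowUnion hμ hlim hδμ le_rfl
        (fun α hα => (hP α hα).1.1) (fun α β h1 h2 => (hR α β h1 h2).1)
        (fun γ h1 h2 => (hL γ h1 h2).1) hU hUμ
      obtain ⟨V', g', h1', h2', h3'⟩ := exists_arrowUnion hμ hlim hδμ le_rfl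
        (fun α hα => (hP α hα).2.1) (fun α β h1 h2 => (hR α β h1 h2).2)
        (fun γ h1 h2 => (hL γ h1 h2).2) (hU.congr fun α hα => (hP α hα).2.2.1.symm) hUμ
      exact ⟨(⟨U, V, g⟩, ⟨U, V', g'⟩), ⟨isTriple_of_isUnion hlim.bot_lt (fun α hα => (hP α hα).1)
          h1 h2 h3, h1', rfl, (hP 0 hlim.bot_lt).2.2.2.1.trans (h2 0 hlim.bot_lt),
          (hP 0 hlim.bot_lt).2.2.2.2.trans (h2' 0 hlim.bot_lt)⟩,
        fun α hα => ⟨h2 α hα, h2' α hα⟩, h3, h3'⟩)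
  have hκ : Order.IsSuccLimit (Order.succ μ).ord :=
    Cardinal.isSuccLimit_ord (hμ.trans (Order.le_succ μ))
  have hsucc : ∀ {α}, α < (Order.succ μ).ord → α + 1 < (Order.succ μ).ord := fun hα => by
    rw [← Order.succ_eq_add_one]; exact hκ.succ_lt hα
  choose! c hc hcs hcE using fun α hα => hfQ α (hsucc hα)
  -- Each `c α` is new at stage `α + 1`, so their images are `μ⁺` distinct elements and cannot all
  -- lie in `C`.
  obtain ⟨α, hα, hαC⟩ : ∃ α < (Order.succ μ).ord,
      (f (α + 1)).2.map (c α) ∉ C.carrier := by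
    by_contra! hall
    have hne : ∀ α β, α < β → β < (Order.succ μ).ord →
        (f (α + 1)).2.map (c α) ≠ (f (β + 1)).2.map (c β) := by
      intro α β hαβ hβ heq
      have hα := hαβ.trans hβ
      have h1 : α + 1 ≤ β := Order.add_one_le_iff.2 hαβ
      have h2 : β ≤ β + 1 := le_self_add
      have hdom : ∀ {α}, α < (Order.succ μ).ord → (f α).2.dom = (f α).1.dom :=
        fun hα => (hfP _ hα).2.2.1
      have hcα := le_subset (hfR _ _ h1 hβ).1.1 (hc α hα)
      have hx : c α ∈ (f (α + 1)).2.dom.carrier := by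
        rw [hdom (hsucc hα)]
        exact hc α hα
      have hx' : c α ∈ (f (β + 1)).2.dom.carrier :=
        le_subset (hfR _ _ (h1.trans h2) (hsucc hβ)).2.1 hx
      have hy : c β ∈ (f (β + 1)).2.dom.carrier := by
        rw [hdom (hsucc hβ)]
        exact hc β hβ
      rw [← (hfR _ _ (h1.trans h2) (hsucc hβ)).2.2.2 _ hx] at heq
      have := (hfP _ (hsucc hβ)).2.1.2.2.inj hx' hy heq
      exact hcs β hβ (this ▸ hcα)
    have hcard := le_card_of_ne hall hne
    have hC' : C.carrier.card = μ := hC.2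
    rw [hC'] at hcard
    exact absurd hcard (Order.lt_succ μ).not_ge
  obtain ⟨E, hE, hsE, k, hk, hks, hkc⟩ := hcE α hα
  obtain ⟨-, hr, hrs, -, hCr⟩ := hfP _ (hsucc hα)
  obtain ⟨hs, -, -, hTs, -⟩ := hfP _ hα
  have hTs' := (hfP _ (hsucc hα)).2.2.2.1
  -- Here `σ` sends the image of `c α` to `b`. That image is outside `C` and `σ` is injective, so
  -- `σ` restricted to `C` omits `b` and gives the forbidden triple with domain `C`.
  obtain ⟨G, hG, hEG, σ, hσ, hσk⟩ := hAP.exists_emb hr.1 hE hr.2.1 (hrs ▸ hk) hr.2.2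
  have hCr' : ∀ x ∈ T.dom.carrier, (f (α + 1)).2.map x = x := hCr.2.2
  have hle : K.le C (f (α + 1)).2.cod := hCr.2.1
  have hcr : c α ∈ (f (α + 1)).2.dom.carrier := by
    rw [hrs]
    exact hc α hα
  refine hno ⟨C, G, σ⟩ ⟨⟨hC, hG, hσ.restrict hle⟩,
    le_subset (K.trans hsE hEG) hs.2.1, fun x hx hxb => hαC ?_⟩
    ⟨hTC, K.trans hTs.2.1 (K.trans hsE hEG), fun x hx => ?_⟩ rfl
  · have h1 := hσk _ hcr
    rw [hkc, ← hxb] at h1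
    rw [hσ.inj (hr.2.2.map_mem hcr) (le_subset hle hx) h1]
    exact hx
  · have h1 := hσk x (le_subset hCr.1 hx)
    rw [hCr' x hx, hks x (le_subset hTs.1 hx), hTs.2.2 x hx] at h1
    exact h1

end AEC

/-! ### Guessing functions -/

section Diamond

variable {κ : Cardinal.{u}}

theorem exists_strict_bound (hκ : κ.IsRegular) {s : Set κ.ord.ToType} (hs : #s < κ) :
    ∃ y, ∀ x ∈ s, x < y := by
  have : ¬ IsCofinal s := fun h => by
    have := Order.cof_le h
    rw [Ordinal.cof_toType, hκ.cof_ord] at this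
    exact this.not_gt hs
  obtain ⟨y, hy⟩ := not_isCofinal_iff.1 this
  exact ⟨y, fun x hx => by simpa using hy x hx⟩

/-- For unboundedness, iterate `ω` times a function bounding `ψ` on initial segments; regularity
gives the bounds, and uncountability keeps the supremum below `κ`. -/
theorem isClub_closed (hκ : κ.IsRegular) (hκ' : ℵ₀ < κ) (ψ : κ.ord.ToType → κ.ord.ToType) :
    IsClub {δ | (∃ β, β < δ) ∧ ∀ β < δ, ψ β < δ} := by
  constructor
  · rintro d hd ⟨x, hx⟩ - a ha
    refine ⟨(hd hx).1.imp fun β hβ => hβ.trans_le (ha.1 hx), fun β hβ => ?_⟩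
    obtain ⟨c, hc, hβc⟩ := (lt_isLUB_iff ha).1 hβ
    exact ((hd hc).2 β hβc).trans_le (ha.1 hc)
  · intro a
    have hb : ∀ x : κ.ord.ToType, ∃ y, x < y ∧ ∀ β < x, ψ β < y := by
      intro x
      have h1 : #(insert x (ψ '' Set.Iio x) : Set κ.ord.ToType) < κ := by
        refine (Cardinal.mk_insert_le).trans_lt (Cardinal.add_lt_of_lt hκ.aleph0_le ?_
          (Cardinal.one_lt_aleph0.trans hκ'))
        refine Cardinal.mk_image_le.trans_lt ?_
        have := Cardinal.mk_Iio_lt x (by simp)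
        rwa [Cardinal.mk_ord_toType] at this
      obtain ⟨y, hy⟩ := exists_strict_bound hκ h1
      exact ⟨y, hy x (Set.mem_insert _ _),
        fun β hβ => hy _ (Set.mem_insert_of_mem _ ⟨β, hβ, rfl⟩)⟩
    choose g hg1 hg2 using hb
    let s : ℕ → κ.ord.ToType := fun n => g^[n] a
    have hs : ∀ n, s (n + 1) = g (s n) := fun n => Function.iterate_succ_apply' g n a
    have hbd : ∃ y, ∀ n, s n < y := by
      obtain ⟨y, hy⟩ := exists_strict_bound hκ (s := Set.range s)
        ((Set.countable_range s).le_aleph0.trans_lt hκ')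
      exact ⟨y, fun n => hy _ ⟨n, rfl⟩⟩
    obtain ⟨δ, hδ, hmin⟩ := WellFounded.has_min (wellFounded_lt (α := κ.ord.ToType))
      {y | ∀ n, s n < y} hbd
    refine ⟨δ, ⟨⟨a, hδ 0⟩, fun β hβ => ?_⟩, (hδ 0).le⟩
    obtain ⟨n, hn⟩ : ∃ n, β ≤ s n := by
      by_contra! hcon
      exact hmin β hcon hβ
    have h1 : β < s (n + 1) := hn.trans_lt ((hs n).symm ▸ hg1 _)
    exact (((hs (n + 1)).symm ▸ hg2 _ β h1 : ψ β < s (n + 1 + 1))).trans (hδ _)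

/-- A function into `T` is guessed through its graph, coded as a subset of `κ` by an injection of `κ
× T`; on a club, the part of the graph over `δ` has its codes below `δ`. -/
theorem Diamond.exists_guess (h : Diamond κ) (hκ : κ.IsRegular) (hκ' : ℵ₀ < κ) {T : Type u}
    [Nonempty T] (hT : #T ≤ κ) :
    ∃ S : Ordinal.{u} → Ordinal.{u} → T, ∀ (f : Ordinal.{u} → T) (φ : Ordinal.{u} → Ordinal.{u}),
      (∀ α < κ.ord, φ α < κ.ord) → ∃ δ < κ.ord, Order.IsSuccLimit δ ∧ (∀ β < δ, φ β < δ) ∧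
        ∀ β < δ, S δ β = f β := by
  classical
  obtain ⟨S, -, hS⟩ := h
  have hκlim : Order.IsSuccLimit κ.ord := Cardinal.isSuccLimit_ord hκ.aleph0_le
  let m := Ordinal.ToType.mk (o := κ.ord)
  obtain ⟨e⟩ : Nonempty (κ.ord.ToType × T ↪ κ.ord.ToType) := by
    rw [← Cardinal.le_def, Cardinal.mk_prod, Cardinal.lift_id, Cardinal.lift_id,
      Cardinal.mk_ord_toType]
    exact Cardinal.mul_le_of_le hκ.aleph0_le le_rfl hT
  refine ⟨fun δ β => if h : ∃ t, ∃ (hδ : δ < κ.ord) (hβ : β < κ.ord),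
    e (m ⟨β, hβ⟩, t) ∈ S (m ⟨δ, hδ⟩) then h.choose else Classical.arbitrary T, fun f φ hφ => ?_⟩
  let X : Set κ.ord.ToType := Set.range fun i => e (i, f (m.symm i).1)
  have hψ : ∀ i : κ.ord.ToType, max (φ (m.symm i).1) ((m.symm i).1 + 1) < κ.ord := fun i =>
    max_lt (hφ _ (m.symm i).2) (by
      rw [← Order.succ_eq_add_one]; exact hκlim.succ_lt (m.symm i).2)
  -- Closure under `ψ` puts the codes of the graph over `δ` below `δ`, closes `δ` under `φ`, and,
  -- through the successor term, makes `δ` a limit.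
  let ψ : κ.ord.ToType → κ.ord.ToType := fun i =>
    max (e (i, f (m.symm i).1)) (m ⟨max (φ (m.symm i).1) ((m.symm i).1 + 1), hψ i⟩)
  obtain ⟨d, hdX, ⟨β₀, hβ₀⟩, hd⟩ := hS X (isClub_closed hκ hκ' ψ)
  have hcl : ∀ β < (m.symm d).1, φ β < (m.symm d).1 ∧ β + 1 < (m.symm d).1 := by
    intro β hβ
    have hβκ : β < κ.ord := hβ.trans (m.symm d).2
    have h1 : m ⟨β, hβκ⟩ < d := by
      rw [← m.lt_symm_apply]
      exact hβ
    have h2 := (le_max_right _ _).trans_lt (hd _ h1)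
    rw [← m.lt_symm_apply] at h2
    simp only [OrderIso.symm_apply_apply] at h2
    exact max_lt_iff.1 h2
  refine ⟨(m.symm d).1, (m.symm d).2, ?_, fun β hβ => (hcl β hβ).1, fun β hβ => ?_⟩
  · rw [Ordinal.isSuccLimit_iff]
    constructor
    · have : (m.symm β₀).1 < (m.symm d).1 := m.symm.lt_iff_lt.2 hβ₀
      exact (pos_of_gt this).ne'
    · rw [Order.isSuccPrelimit_iff_succ_lt]
      intro β hβ
      rw [Order.succ_eq_add_one]
      exact (hcl β hβ).2
  · have hβκ : β < κ.ord := hβ.trans (m.symm d).2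
    have h1 : m ⟨β, hβκ⟩ < d := by
      rw [← m.lt_symm_apply]
      exact hβ
    have hmem : ∀ {t}, e (m ⟨β, hβκ⟩, t) ∈ S d ↔ e (m ⟨β, hβκ⟩, t) ∈ X ∩ Set.Iio d := by
      intro t
      rw [show X ∩ Set.Iio d = S d from hdX]
    have hex : ∃ t, ∃ (hδ : (m.symm d).1 < κ.ord) (hβ : β < κ.ord),
        e (m ⟨β, hβ⟩, t) ∈ S (m ⟨(m.symm d).1, hδ⟩) := by
      refine ⟨f β, (m.symm d).2, hβκ, ?_⟩
      rw [Subtype.coe_eta, OrderIso.apply_symm_apply, hmem]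
      refine ⟨⟨m ⟨β, hβκ⟩, ?_⟩, ?_⟩
      · beta_reduce
        rw [OrderIso.symm_apply_apply]
      · have h2 := (le_max_left _ _).trans_lt (hd _ h1)
        rwa [OrderIso.symm_apply_apply] at h2
    beta_reduce
    rw [dif_pos hex]
    obtain ⟨hδ, hβ', h2⟩ := hex.choose_spec
    rw [show m ⟨(m.symm d).1, hδ⟩ = d from m.apply_symm_apply d, hmem] at h2
    obtain ⟨⟨i, hi⟩, -⟩ := h2
    have h3 := e.injective hi
    rw [Prod.mk.injEq] at h3
    obtain ⟨rfl, h4⟩ := h3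
    rw [OrderIso.symm_apply_apply] at h4
    exact h4.symm

end Diamond

/-! ### The tree of triples. -/

namespace AEC

variable {L : FirstOrder.Language.{u, u}} {K : AEC L} {μ : Cardinal.{u}} {b : ZFSet.{u}}

/-- The branch that agrees with `η` below `α` and is constant from `α` on. -/
noncomputable def cut (α : Ordinal.{u}) (η : Ordinal.{u} → Bool) : Ordinal.{u} → Bool :=
  open Classical in fun β => if β < α then η β else false

theorem cut_apply {α β : Ordinal.{u}} (η : Ordinal.{u} → Bool) (h : β < α) : cut α η β = η β :=
  if_pos h

theorem cut_congr {α : Ordinal.{u}} {η ν : Ordinal.{u} → Bool} (h : ∀ β < α, η β = ν β) :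
    cut α η = cut α ν := by
  classical
  funext β
  unfold cut
  split_ifs with hβ
  · exact h β hβ
  · rfl

/-- A family of triples with a common domain, indexed by the branches of length `α`. -/
structure IsLevel (K : AEC L) (μ : Cardinal.{u}) (b : ZFSet.{u}) (T : Arrow L) (α : Ordinal.{u})
    (s : (Ordinal.{u} → Bool) → Arrow L) : Prop where
  isTriple : ∀ η, K.IsTriple μ b (s η)
  dom_eq : ∀ η ν, (s η).dom = (s ν).dom
  extends_base : ∀ η, K.Extends T (s η)
  congr : ∀ η ν, (∀ β < α, η β = ν β) → s η = s ν

/-- The level `s'` splits the level `s`, of length `α`, at the branch `ρ`. -/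
def Splits (K : AEC L) (α : Ordinal.{u}) (ρ : Ordinal.{u} → Bool)
    (s s' : (Ordinal.{u} → Bool) → Arrow L) : Prop :=
  (∃ x ∈ (s' ρ).dom.carrier, x ∉ (s ρ).dom.carrier) ∧
    ∃ s₀ s₁, K.Incompatible (s ρ) s₀ s₁ ∧
      ∀ η, (∀ β < α, η β = ρ β) → s' η = if η α then s₁ else s₀

/-- Only the node at `ρ` is split; homogeneity of `T` then moves all the other nodes to the new
common domain while keeping `b` outside the ranges. -/
theorem IsLevel.exists_splits (hAP : K.AmalgamationProperty μ) {A B : TauModel L}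
    (hnd : ∀ C D, K.le A C → K.le B D → ¬ K.IsDominationTriple μ C D b) (hAB : K.le A B)
    {T : Arrow L} (hT₀ : K.Extends ⟨A, B, id⟩ T) (hhom : K.Homogeneous μ b T) {α : Ordinal.{u}}
    {s : (Ordinal.{u} → Bool) → Arrow L} (hs : K.IsLevel μ b T α s) (ρ : Ordinal.{u} → Bool) :
    ∃ s', K.IsLevel μ b T (α + 1) s' ∧ (∀ η, K.Extends (s η) (s' η)) ∧ K.Splits α ρ s s' := by
  classical
  obtain ⟨s₀, s₁, h₀, h₁, hinc⟩ := exists_incompatible hnd hAB (hs.isTriple ρ)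
    (hT₀.trans (hs.extends_base ρ))
  choose v hv hsv hvdom using fun η => hhom (s ρ) (s η) s₀ (hs.isTriple ρ) (hs.isTriple η) h₀
    (hs.extends_base ρ) (hs.extends_base η) (hs.dom_eq ρ η) hinc.2.1
  have hα : α < α + 1 := Order.lt_add_one_iff.2 le_rfl
  -- Choosing at `cut α η` instead of `η` makes the result depend only on `η` below `α`.
  let s' : (Ordinal.{u} → Bool) → Arrow L := fun η =>
    if ∀ β < α, η β = ρ β then (if η α then s₁ else s₀) else v (cut α η)
  have hs' : ∀ η, (∀ β < α, η β = ρ β) → s' η = if η α then s₁ else s₀ := fun η h => if_pos h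
  have hs'' : ∀ η, ¬ (∀ β < α, η β = ρ β) → s' η = v (cut α η) := fun η h => if_neg h
  have hcut : ∀ η, s (cut α η) = s η := fun η => hs.congr _ _ fun β hβ => cut_apply η hβ
  have hall : ∀ η, K.IsTriple μ b (s' η) ∧ (s' η).dom = s₀.dom ∧ K.Extends (s η) (s' η) := by
    intro η
    by_cases h : ∀ β < α, η β = ρ β
    · rw [hs' η h, hs.congr η ρ h]
      cases η α
      · exact ⟨h₀, rfl, hinc.2.1⟩
      · exact ⟨h₁, hinc.1.symm, hinc.2.2.1⟩
    · rw [hs'' η h]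
      exact ⟨hv _, hvdom _, hcut η ▸ hsv (cut α η)⟩
  refine ⟨s', ⟨fun η => (hall η).1, fun η ν => (hall η).2.1.trans (hall ν).2.1.symm,
    fun η => (hs.extends_base η).trans (hall η).2.2, fun η ν h => ?_⟩, fun η => (hall η).2.2, ?_,
    s₀, s₁, hinc, hs'⟩
  · have hlt : ∀ β < α, η β = ν β := fun β hβ => h β (hβ.trans hα)
    by_cases h' : ∀ β < α, η β = ρ β
    · rw [hs' η h', hs' ν fun β hβ => (hlt β hβ).symm.trans (h' β hβ), h α hα]
    · rw [hs'' η h', hs'' ν fun h'' => h' fun β hβ => (hlt β hβ).trans (h'' β hβ), cut_congr hlt]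
  · rw [(hall ρ).2.1]
    exact hinc.exists_new hAP (hs.isTriple ρ).1 h₀.1 h₁.1

theorem exists_level_union (hμ : ℵ₀ ≤ μ) {T : Arrow L} {δ : Ordinal.{u}}
    (hδ : δ < (Order.succ μ).ord) (hlim : Order.IsSuccLimit δ)
    {f : Ordinal.{u} → (Ordinal.{u} → Bool) → Arrow L} (hP : ∀ α < δ, K.IsLevel μ b T α (f α))
    (hR : ∀ α β, α ≤ β → β < δ → ∀ η, K.Extends (f α η) (f β η))
    (hL : ∀ γ < δ, Order.IsSuccLimit γ → ∀ η, IsArrowUnion γ (fun α => f α η) (f γ η)) :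
    ∃ s, K.IsLevel μ b T δ s ∧ (∀ α < δ, ∀ η, K.Extends (f α η) (s η)) ∧
      ∀ η, IsArrowUnion δ (fun α => f α η) (s η) := by
  have hδμ := card_le_of_lt_ord_succ hδ
  let η₀ : Ordinal.{u} → Bool := fun _ => false
  have hch := (isChain_of_arrows (fun α β h1 h2 => hR α β h1 h2 η₀)
    fun γ h1 h2 => hL γ h1 h2 η₀).1
  obtain ⟨U, hU⟩ := hch.exists_isUnion hlim.bot_lt
  have hUμ := hch.card_union hlim.bot_lt hU hμ hδμ fun α hα => ((hP α hα).isTriple η₀).1.1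
  choose V g h1 h2 h3 using fun η => exists_arrowUnion hμ hlim hδμ le_rfl
    (fun α hα => ((hP α hα).isTriple η).1) (fun α β h1 h2 => hR α β h1 h2 η)
    (fun γ h1 h2 => hL γ h1 h2 η) (hU.congr fun α hα => (hP α hα).dom_eq η₀ η) hUμ
  have hcut : ∀ η, ∀ α < δ, f α (cut δ η) = f α η := fun η α hα =>
    (hP α hα).congr _ _ fun β hβ => cut_apply η (hβ.trans hα)
  refine ⟨fun η => ⟨U, V (cut δ η), g (cut δ η)⟩, ⟨fun η => ?_, fun _ _ => rfl, fun η => ?_,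
    fun η ν h => by rw [cut_congr h]⟩, fun α hα η => ?_, fun η => ?_⟩
  · exact isTriple_of_isUnion hlim.bot_lt (fun α hα => (hP α hα).isTriple _) (h1 _) (h2 _) (h3 _)
  · exact ((hP 0 hlim.bot_lt).extends_base _).trans (h2 _ 0 hlim.bot_lt)
  · rw [← hcut η α hα]
    exact h2 _ α hα
  · exact (h3 (cut δ η)).congr (hcut η)

/-- The tree of triples along which every level is split at a prescribed branch. -/
theorem exists_tree (hμ : ℵ₀ ≤ μ) (hAP : K.AmalgamationProperty μ) {A B : TauModel L}
    (hnd : ∀ C D, K.le A C → K.le B D → ¬ K.IsDominationTriple μ C D b) (hAB : K.le A B)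
    {T : Arrow L} (hT : K.IsTriple μ b T) (hT₀ : K.Extends ⟨A, B, id⟩ T)
    (hhom : K.Homogeneous μ b T) (ρ : Ordinal.{u} → Ordinal.{u} → Bool) :
    ∃ F : Ordinal.{u} → (Ordinal.{u} → Bool) → Arrow L,
      (∀ α < (Order.succ μ).ord, K.IsLevel μ b T α (F α)) ∧
      (∀ α β, α ≤ β → β < (Order.succ μ).ord → ∀ η, K.Extends (F α η) (F β η)) ∧
      (∀ α < (Order.succ μ).ord, K.Splits α (ρ α) (F α) (F (α + 1))) ∧
      ∀ γ < (Order.succ μ).ord, Order.IsSuccLimit γ →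
        ∀ η, IsArrowUnion γ (fun α => F α η) (F γ η) := by
  obtain ⟨F, -, hP, hR, hQ, hL⟩ := exists_transfinite_sequence
    (S := (Ordinal.{u} → Bool) → Arrow L) (Order.succ μ).ord (fun α s => K.IsLevel μ b T α s)
    (fun s t => ∀ η, K.Extends (s η) (t η)) (fun α s s' => K.Splits α (ρ α) s s')
    (fun δ f s => ∀ η, IsArrowUnion δ (fun α => f α η) (s η))
    (fun _ s h η => (h.isTriple η).1.extends_refl) (fun _ _ _ h h' η => (h η).trans (h' η))
    (fun δ f g s h h' η => (h' η).congr fun α hα => by rw [h α hα])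
    (fun _ => T) ⟨fun _ => hT, fun _ _ => rfl, fun _ => hT.1.extends_refl, fun _ _ _ => rfl⟩
    (fun α _ s hs => hs.exists_splits hAP hnd hAB hT₀ hhom (ρ α))
    (fun δ hδ hlim f => exists_level_union hμ hδ hlim)
  have hκ : Order.IsSuccLimit (Order.succ μ).ord :=
    Cardinal.isSuccLimit_ord (hμ.trans (Order.le_succ μ))
  refine ⟨F, hP, hR, fun α hα => hQ α ?_, hL⟩
  rw [← Order.succ_eq_add_one]
  exact hκ.succ_lt hα

end AEC

/-! ### Codes for elements and pairs. -/

theorem ZFSet.exists_code {κ : Cardinal.{u}} (hκ : κ ≠ 0) {Z : ZFSet.{u}} (hZ : Z.card ≤ κ) :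
    ∃ c : ZFSet.{u} → κ.ord.ToType, Set.InjOn c {x | x ∈ Z} := by
  classical
  obtain ⟨e⟩ : Nonempty (Z ↪ κ.ord.ToType) := by
    rw [← Cardinal.lift_mk_le', ZFSet.cardinalMk_coe_sort, Cardinal.mk_ord_toType,
      Cardinal.lift_lift, Cardinal.lift_le]
    exact hZ
  have : Nonempty κ.ord.ToType := Cardinal.nonempty_ord_toType hκ
  obtain ⟨c, hc⟩ : ∃ c : ZFSet.{u} → κ.ord.ToType, ∀ {x} (h : x ∈ Z), c x = e ⟨x, h⟩ :=
    ⟨fun x => if h : x ∈ Z then e ⟨x, h⟩ else Classical.arbitrary κ.ord.ToType,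
      fun h => dif_pos h⟩
  refine ⟨c, fun x hx y hy hxy => ?_⟩
  rw [hc hx, hc hy] at hxy
  exact congrArg Subtype.val (e.injective hxy)

theorem ZFSet.exists_enumeration {μ : Cardinal.{u}} (hμ : μ ≠ 0) :
    ∃ en : ZFSet.{u} → μ.ord.ToType → ZFSet.{u},
      ∀ Z : ZFSet.{u}, Z.card ≤ μ → ∀ x ∈ Z, ∃ j, en Z j = x := by
  have : ∀ Z : ZFSet.{u}, ∃ en : μ.ord.ToType → ZFSet.{u}, Z.card ≤ μ → ∀ x ∈ Z, ∃ j, en j = x := by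
    intro Z
    by_cases hZ : Z.card ≤ μ
    · obtain ⟨c, hc⟩ := ZFSet.exists_code hμ hZ
      exact ⟨Function.invFunOn c {x | x ∈ Z}, fun _ x hx => ⟨c x, hc.leftInvOn_invFunOn hx⟩⟩
    · exact ⟨fun _ => ∅, fun h => absurd h hZ⟩
  choose en hen using this
  exact ⟨en, hen⟩

/-- All pairs are listed in length `μ⁺`, and `φ` bounds the positions of those with a given first
entry. Hence a `δ` closed under `φ` sees every pair `(α, j)` with `α < δ` before `δ`. -/
theorem exists_pairing {μ : Cardinal.{u}} (hμ : ℵ₀ ≤ μ) :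
    ∃ (p : Ordinal.{u} → Ordinal.{u} × μ.ord.ToType) (φ : Ordinal.{u} → Ordinal.{u}),
      ∀ α < (Order.succ μ).ord, φ α < (Order.succ μ).ord ∧ ∀ j, ∃ β < φ α, p β = (α, j) := by
  classical
  have hreg := Cardinal.isRegular_succ hμ
  let κ := Order.succ μ
  have : Nonempty μ.ord.ToType :=
    Cardinal.nonempty_ord_toType (Cardinal.aleph0_pos.trans_le hμ).ne'
  let m := Ordinal.ToType.mk (o := κ.ord)
  obtain ⟨q⟩ : Nonempty (κ.ord.ToType × μ.ord.ToType ↪ κ.ord.ToType) := by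
    rw [← Cardinal.le_def, Cardinal.mk_prod, Cardinal.lift_id, Cardinal.lift_id,
      Cardinal.mk_ord_toType, Cardinal.mk_ord_toType]
    exact Cardinal.mul_le_of_le hreg.aleph0_le le_rfl (Order.le_succ μ)
  have hb : ∀ i : κ.ord.ToType, ∃ y, ∀ j, q (i, j) < y := by
    intro i
    obtain ⟨y, hy⟩ := exists_strict_bound hreg (s := Set.range fun j => q (i, j)) (by
      refine Cardinal.mk_range_le.trans_lt ?_
      rw [Cardinal.mk_ord_toType]
      exact Order.lt_succ μ)
    exact ⟨y, fun j => hy _ ⟨j, rfl⟩⟩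
  choose y hy using hb
  refine ⟨fun β => if h : ∃ x : κ.ord.ToType × μ.ord.ToType, (m.symm (q x)).1 = β then
      ((m.symm h.choose.1).1, h.choose.2) else (0, Classical.arbitrary _),
    fun α => if h : α < κ.ord then (m.symm (y (m ⟨α, h⟩))).1 else 0, fun α hα => ?_⟩
  beta_reduce
  rw [dif_pos hα]
  refine ⟨(m.symm (y (m ⟨α, hα⟩))).2, fun j =>
    ⟨(m.symm (q (m ⟨α, hα⟩, j))).1, m.symm.lt_iff_lt.2 (hy _ j), ?_⟩⟩
  have hex : ∃ x : κ.ord.ToType × μ.ord.ToType,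
      (m.symm (q x)).1 = (m.symm (q (m ⟨α, hα⟩, j))).1 := ⟨_, rfl⟩
  rw [dif_pos hex]
  have h1 := q.injective (m.symm.injective (Subtype.ext hex.choose_spec))
  rw [h1]
  simp only [OrderIso.symm_apply_apply]

/-! ### The diamond argument. -/

namespace AEC

variable {L : FirstOrder.Language.{u, u}} {K : AEC L} {μ : Cardinal.{u}} {b : ZFSet.{u}}

/-- The union of a branch of the tree, as an embedding between models of cardinality `μ⁺`. -/
theorem exists_branch_union (hμ : ℵ₀ ≤ μ) {T : Arrow L} {ρ : Ordinal.{u} → Ordinal.{u} → Bool}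
    {F : Ordinal.{u} → (Ordinal.{u} → Bool) → Arrow L}
    (hF : ∀ α < (Order.succ μ).ord, K.IsLevel μ b T α (F α))
    (hFR : ∀ α β, α ≤ β → β < (Order.succ μ).ord → ∀ η, K.Extends (F α η) (F β η))
    (hFS : ∀ α < (Order.succ μ).ord, K.Splits α (ρ α) (F α) (F (α + 1)))
    (hFL : ∀ γ < (Order.succ μ).ord, Order.IsSuccLimit γ →
      ∀ η, IsArrowUnion γ (fun α => F α η) (F γ η)) :
    ∃ M ∈ K.ofCard (Order.succ μ), ∀ η, ∃ V g, K.IsArrow (Order.succ μ) ⟨M, V, g⟩ ∧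
      ∀ α < (Order.succ μ).ord, K.Extends (F α η) ⟨M, V, g⟩ := by
  have hμ' : ℵ₀ ≤ Order.succ μ := hμ.trans (Order.le_succ μ)
  have hκ : Order.IsSuccLimit (Order.succ μ).ord := Cardinal.isSuccLimit_ord hμ'
  have hκc : (Order.succ μ).ord.card ≤ Order.succ μ := (Cardinal.card_ord _).le
  have hsucc : ∀ {α}, α < (Order.succ μ).ord → α + 1 < (Order.succ μ).ord := fun hα => by
    rw [← Order.succ_eq_add_one]; exact hκ.succ_lt hα
  let η₀ : Ordinal.{u} → Bool := fun _ => false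
  have hch := (isChain_of_arrows (fun α β h1 h2 => hFR α β h1 h2 η₀)
    fun γ h1 h2 => hFL γ h1 h2 η₀).1
  obtain ⟨M, hM⟩ := hch.exists_isUnion hκ.bot_lt
  choose! x hx hx' using fun α hα => (hFS α hα).1
  have hMc : M ∈ K.ofCard (Order.succ μ) := by
    refine ⟨(K.le_mem (hch.le_union hM hκ.bot_lt)).2, le_antisymm (hM.card_le hμ' hκc
      fun α hα => ((hF α hα).isTriple η₀).1.1.2.le.trans (Order.le_succ μ)) ?_⟩
    -- The elements added by the splits at the successive levels are pairwise distinct, which gives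
    -- the lower bound `μ⁺`.
    refine le_card_of_ne (x := x) (fun α hα => ?_) fun α β hαβ hβ heq => ?_
    · have h1 := hx α hα
      rw [(hF _ (hsucc hα)).dom_eq _ η₀] at h1
      exact le_subset (hch.le_union hM (hsucc hα)) h1
    · have h1 := hx α (hαβ.trans hβ)
      rw [(hF _ (hsucc (hαβ.trans hβ))).dom_eq _ (ρ β), heq] at h1
      exact hx' β hβ (le_subset (hFR _ _ (Order.add_one_le_iff.2 hαβ) hβ _).1 h1)
  refine ⟨M, hMc, fun η => ?_⟩
  obtain ⟨V, g, h1, h2, -⟩ := exists_arrowUnion hμ' hκ hκc (Order.le_succ μ)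
    (fun α hα => ((hF α hα).isTriple η).1) (fun α β h1 h2 => hFR α β h1 h2 η)
    (fun γ h1 h2 => hFL γ h1 h2 η) (hM.congr fun α hα => (hF α hα).dom_eq η₀ η) hMc
  exact ⟨V, g, h1, h2⟩

theorem exists_isDominationTriple (hμ : ℵ₀ ≤ μ) (hdiamond : Diamond (Order.succ μ))
    (hLST : K.LST ≤ μ) (hAP : K.AmalgamationProperty μ)
    (hAP' : K.AmalgamationProperty (Order.succ μ)) (hstable : K.Stable (Order.succ μ))
    {A B : TauModel L} (hA : A ∈ K.ofCard μ) (hB : B ∈ K.ofCard μ) (hAB : K.le A B)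
    (hbB : b ∈ B.carrier) (hbA : b ∉ A.carrier) :
    ∃ C D, K.le A C ∧ K.le B D ∧ K.IsDominationTriple μ C D b := by
  classical
  by_contra! hnd
  have hμ' : ℵ₀ ≤ Order.succ μ := hμ.trans (Order.le_succ μ)
  have hsucc : ∀ {α}, α < (Order.succ μ).ord → α + 1 < (Order.succ μ).ord := fun hα => by
    rw [← Order.succ_eq_add_one]
    exact (Cardinal.isSuccLimit_ord hμ').succ_lt hα
  have hne : Nonempty (Order.succ μ).ord.ToType :=
    Cardinal.nonempty_ord_toType (Cardinal.aleph0_pos.trans_le hμ').ne'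
  obtain ⟨S, hS⟩ := hdiamond.exists_guess (Cardinal.isRegular_succ hμ)
    (hμ.trans_lt (Order.lt_succ μ)) (T := Bool × (Order.succ μ).ord.ToType) (by
      rw [Cardinal.mk_prod, Cardinal.lift_uzero, Cardinal.mk_ord_toType]
      refine Cardinal.mul_le_of_le hμ' (le_trans ?_ hμ') le_rfl
      rw [Cardinal.lift_le_aleph0]
      exact Cardinal.mk_le_aleph0)
  obtain ⟨p, φ, hp⟩ := exists_pairing hμ
  obtain ⟨en, hen⟩ := ZFSet.exists_enumeration (Cardinal.aleph0_pos.trans_le hμ).ne'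
  obtain ⟨T, hT, hT₀, hhom⟩ := exists_homogeneous hμ hAP (T₀ := ⟨A, B, id⟩)
    ⟨⟨hA, hB, emb_of_le hAB⟩, hbB, fun x hx h => hbA (h ▸ hx)⟩
  let ρ : Ordinal.{u} → Ordinal.{u} → Bool := fun δ β => (S δ β).1
  obtain ⟨F, hF, hFR, hFS, hFL⟩ := exists_tree hμ hAP hnd hAB hT hT₀ hhom ρ
  obtain ⟨M, hM, hbranch⟩ := exists_branch_union hμ hF hFR hFS hFL
  obtain ⟨N, hN, hMN, huniv⟩ := exists_universal hμ' (hLST.trans (Order.le_succ μ)) hAP' hstable hM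
  obtain ⟨code, hcode⟩ := ZFSet.exists_code (Cardinal.aleph0_pos.trans_le hμ').ne' hN.2.le
  have : Nonempty (Arrow L) := ⟨T⟩
  choose! s₀ s₁ hinc hsplit using fun α hα => (hFS α hα).2
  -- This lists the codomains along `η`, the entry `y η β` depending only on `η` below `(p β).1`. An
  -- embedding is thus guessed by the codes of its values on this list.
  let y : (Ordinal.{u} → Bool) → Ordinal.{u} → ZFSet.{u} :=
    fun η β => en (F (p β).1 η).cod.carrier (p β).2
  let Lifts : Ordinal.{u} → Arrow L → (ZFSet.{u} → ZFSet.{u}) → Prop := fun δ s h =>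
    K.Emb s.cod N h ∧ (∀ x ∈ s.dom.carrier, h (s.map x) = x) ∧
      ∀ β < δ, (p β).1 < δ → code (h (y (ρ δ) β)) = (S δ β).2
  -- The tree, `M` and `N` are fixed before `η`, so there is no circularity: `η` decides against the
  -- guess at every level.
  let η : Ordinal.{u} → Bool := fun δ => decide (∃ h, Lifts δ (s₀ δ) h)
  obtain ⟨V, g, hV, hext⟩ := hbranch η
  obtain ⟨h, hh, hhg⟩ := huniv V hV.2.1 g hV.2.2
  obtain ⟨δ, hδ, hlim, hφ, hguess⟩ := hS (fun β => (η β, code (h (y η β)))) φ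
    fun α hα => (hp α hα).1
  have hηρ : ∀ β < δ, η β = ρ δ β := fun β hβ => (congrArg Prod.fst (hguess β hβ)).symm
  have hy : ∀ β, (p β).1 < δ → y η β = y (ρ δ) β := by
    intro β hβ
    have : F (p β).1 η = F (p β).1 (ρ δ) :=
      (hF _ (hβ.trans hδ)).congr _ _ fun γ hγ => hηρ γ (hγ.trans hβ)
    simp only [y, this]
  have hnext := hsplit δ hδ η hηρ
  have hextδ := hext _ (hsucc hδ)
  have hlift : Lifts δ (F (δ + 1) η) h := by
    refine ⟨hh.restrict hextδ.2.1, fun x hx => ?_, fun β hβ hpβ => ?_⟩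
    · rw [← hextδ.2.2 x hx]
      exact hhg x (le_subset hextδ.1 hx)
    · rw [← hy β hpβ, hguess β hβ]
  by_cases hex : ∃ h, Lifts δ (s₀ δ) h
  · have hη : η δ = true := decide_eq_true hex
    rw [hnext, hη, if_pos rfl] at hlift
    obtain ⟨h₀, hh₀⟩ := hex
    obtain ⟨hdom, he₀, he₁, hinc'⟩ := hinc δ hδ
    -- Both maps have the guessed values on the list, hence they agree on the codomain at level `δ`,
    -- a union of earlier codomains; on the common domain both invert the arrows.
    refine hinc' ⟨N, h₀, h, hh₀.1, hlift.1, fun x hx => ?_, fun x hx => ?_⟩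
    · obtain ⟨α, hα, hxα⟩ := ((hFL δ hδ hlim (ρ δ)).2.1 x).1 hx
      obtain ⟨j, hj⟩ := hen _ ((hF α (hα.trans hδ)).isTriple (ρ δ)).1.2.1.2.le x hxα
      obtain ⟨β, hβ, hpβ⟩ := (hp α (hα.trans hδ)).2 j
      have hβδ := hβ.trans (hφ α hα)
      have hpδ : (p β).1 < δ := by rwa [hpβ]
      have hyx : y (ρ δ) β = x := by
        simp only [y, hpβ]
        exact hj
      have h1 := hh₀.2.2 β hβδ hpδ
      have h2 := hlift.2.2 β hβδ hpδ
      rw [hyx] at h1 h2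
      exact hcode (hh₀.1.map_mem (le_subset he₀.2.1 hx)) (hlift.1.map_mem (le_subset he₁.2.1 hx))
        (h1.trans h2.symm)
    · rw [hh₀.2.1 x hx, hlift.2.1 x (hdom ▸ hx)]
  · have hη : η δ = false := decide_eq_false hex
    rw [hnext, hη] at hlift
    exact hex ⟨h, hlift⟩

end AEC

theorem corollary12p8 {L : FirstOrder.Language.{u, u}} (K : AEC L) (lam : Cardinal.{u})
    (hlam : ℵ₀ ≤ lam) (hdiamond : Diamond (Order.succ lam))
    (hLST : K.LST ≤ lam) (hAP : K.AmalgamationProperty lam) (hNM : K.NoMaximalModel lam)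
    (hAP' : K.AmalgamationProperty (Order.succ lam)) (hstable : K.Stable (Order.succ lam))
    (A B : TauModel L) (hA : A ∈ K.ofCard lam) (hB : B ∈ K.ofCard lam) (hAB : K.lt A B)
    (b : ZFSet.{u}) (hbB : b ∈ B.carrier) (hbA : b ∉ A.carrier) :
    ∃ C ∈ K.ofCard lam, ∃ D ∈ K.ofCard lam,
      K.IsDominationTriple lam C D b ∧
      ∃ (hAC : K.le A C) (_ : K.le B D) (hCD : K.le C D) (hbD : b ∈ D.carrier),
        (AEC.tp hCD ⟨b, hbD⟩).restrict hAC = AEC.tp hAB.1 ⟨b, hbB⟩ := by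
  obtain ⟨C, D, hAC, hBD, hdom⟩ := AEC.exists_isDominationTriple hlam hdiamond hLST hAP hAP'
    hstable hA hB hAB.1 hbB hbA
  obtain ⟨hC, hD, hCD, hbD, -⟩ := hdom.1
  refine ⟨C, hC, D, hD, hdom, hAC, hBD, hCD.1, hbD, ?_⟩
  exact (AEC.tp_eq_of_emb hAB.1 (K.trans hAC hCD.1) (AEC.emb_of_le hBD) (fun _ _ => rfl) ⟨b, hbB⟩
    ⟨b, hbD⟩ rfl).symm
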